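/- For $d=2$, $z\in\mathbb C\setminus[0,8]$ and $n=(n_1,n_2)\in\mathbb Z^2$ let $$G(z,n)=(2\pi)^{-2}\int_{[-\pi,\pi]^2}\frac{e^{i(n_1\theta_1+n_2\theta_2)}}{4-2\cos\theta_1-2\cos\theta_2-z}\,d\theta ,\qquad \mathcal P_0(m)=(-1)^mG(z,(m,m))\quad(m\in\mathbb Z).$$ Let $(q)_k=q(q+1)\cdots(q+k-1)$ (with $(q)_0=1$), let $\psi=\Gamma'/\Gamma$, and let $\log$ be the principal branch of the logarithm. (1) For any $z\in\mathbb C$ with $|z-4|<4$ and $\operatorname{Im}z>0$, and any $m\in\mathbb Z$, $$\mathcal P_0(m)=\frac{i}{4\pi}\sum_{k=0}^\infty\frac{\left(\frac12+m\right)_k\left(\frac12-m\right)_k}{k!\,k!}\left(\frac{z-4}{4}\right)^{2k}\left[2\psi(1+k)-\psi\left(\tfrac12+m+k\right)-\psi\left(\tfrac12-m+k\right)-\log\left(-\frac{(z-4)^2}{16}\right)\right].$$ (2) For any $z\in\mathbb C\setminus[0,8]$ with $|z(8-z)|<16$ and $\pm\operatorname{Re}(4-z)>0$, and any $m\in\mathbb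 Z$, $$\mathcal P_0(m)=\pm\frac{(-1)^m}{4\pi}\sum_{k=0}^\infty\frac{\left(\frac12+m\right)_k\left(\frac12-m\right)_k}{k!\,k!}\left(\frac{z(8-z)}{16}\right)^{k}\left[2\psi(1+k)-\psi\left(\tfrac12+m+k\right)-\psi\left(\tfrac12-m+k\right)-\log\frac{z(z-8)}{16}\right],$$ respectively. All the series converge absolutely. -/

import Mathlib

open scoped Nat

/-- The resolvent kernel of the discrete Laplacian on `ℤ^d`,
`G(z,n) = (2π)^{-d} ∫_{𝕋^d} e^{i n·θ} / (2d - 2 cos θ₁ - ⋯ - 2 cos θ_d - z) dθ`,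
for `z ∈ ℂ \ [0,4d]`; the torus `𝕋^d = (ℝ/2πℤ)^d` is represented by the fundamental domain
`[-π,π]^d` with Lebesgue measure. -/
noncomputable def latticeGreen (d : ℕ) (z : ℂ) (n : Fin d → ℤ) : ℂ :=
  ((2 * Real.pi : ℝ) : ℂ)⁻¹ ^ d *
    ∫ θ in Set.Icc (fun _ : Fin d => -Real.pi) (fun _ : Fin d => Real.pi),
      Complex.exp (Complex.I * ∑ j, (n j : ℂ) * (θ j : ℂ)) /
        (2 * (d : ℂ) - ∑ j, 2 * Complex.cos (θ j : ℂ) - z)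

/-- The diagonal values `P₀(m) = (-1)^m G(z,m,m)` in dimension two. -/
noncomputable def diagonalValue (z : ℂ) (m : ℤ) : ℂ :=
  (-1 : ℂ) ^ m * latticeGreen 2 z ![m, m]

/-- The `k`-th term
`(1/2+m)_k (1/2-m)_k / (k! k!) · w^k · [2ψ(1+k) - ψ(1/2+m+k) - ψ(1/2-m+k) - L]`,
where `(q)_k = q (q+1) ⋯ (q+k-1)` is the Pochhammer symbol and `ψ = Γ'/Γ` is the digamma
function. -/
noncomputable def diagonalTerm (m : ℤ) (w L : ℂ) (k : ℕ) : ℂ :=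
  (ascPochhammer ℂ k).eval (1 / 2 + (m : ℂ)) * (ascPochhammer ℂ k).eval (1 / 2 - (m : ℂ)) /
      ((k ! : ℂ) * (k ! : ℂ)) * w ^ k *
    (2 * Complex.digamma (1 + (k : ℂ)) - Complex.digamma (1 / 2 + (m : ℂ) + (k : ℂ))
      - Complex.digamma (1 / 2 - (m : ℂ) + (k : ℂ)) - L)

/-! Put l = (4 - z)/4. With y = θ₁ + θ₂ and x half the difference of the angles, the denominator
becomes 4(l - cos(y/2) cos x), and the x-integral is explicit: 2π/√(l² - cos²(y/2)) up to the factor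
1/4 (`integral_inv_sub_mul_cos`). A single integral over y remains.

If l² = 1 + t with t > 0, the radicand is t + sin²(y/2), and G is ±1/(4π) times J(t) = 2∫₀^{π/2}
cos(2ma) (t + sin² a)^{-1/2} da. If l = -i√t, the radicand is -(t + cos²(y/2)); translating y by π
gives J(t) again, with a factor i and the sign (-1)^m that P₀ removes. Hence both parts rest on one
expansion of J.

In u = log t, J satisfies the hypergeometric equation with parameters 1/2 + m, 1/2 - m; 1 at the
point -t (`quarterIntegral_relation`). So does the Frobenius series with w = -t and L = log t. Both
are -log t + 2ψ(1) - ψ(1/2+m) - ψ(1/2-m) + o(1) as t → 0+, and their u-derivatives both tend to -1.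
A Wronskian argument then makes them equal for small t (`eventually_diagonalIntegral_eq`).

The Green function is holomorphic off [0,8] and the series is holomorphic on the unit disc cut along
(-1,0], so the identity theorem extends the equality to complex t (`eqOn_tsum_diagonalTerm`). Part
(1) is t = -l², part (2) is t = l² - 1; the half-plane containing z fixes the branch of the square
root. -/

/-! ### Power series with coefficients of polynomial growth. -/

/-- A sequence of at most polynomial growth. -/
def PolyGrowth (a : ℕ → ℂ) : Prop := ∃ (C : ℝ) (n : ℕ), ∀ k : ℕ, ‖a k‖ ≤ C * ((k : ℝ) + 1) ^ n

/-- The sum of the power series with coefficients `a`. -/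
noncomputable def seriesSum (a : ℕ → ℂ) (x : ℂ) : ℂ := ∑' k : ℕ, a k * x ^ k

namespace PolyGrowth

variable {a b : ℕ → ℂ}

theorem natCast_mul (h : PolyGrowth a) : PolyGrowth (fun k => (k : ℂ) * a k) := by
  obtain ⟨C, n, h⟩ := h
  refine ⟨C, n + 1, fun k => ?_⟩
  rw [norm_mul, Complex.norm_natCast, pow_succ]
  have h1 := h k
  have h2 : (k : ℝ) * ‖a k‖ ≤ ((k : ℝ) + 1) * ‖a k‖ := by
    gcongr; linarith
  have h3 : ((k : ℝ) + 1) * ‖a k‖ ≤ ((k : ℝ) + 1) * (C * ((k : ℝ) + 1) ^ n) := by gcongr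
  linarith

theorem const_mul (h : PolyGrowth a) (c : ℂ) : PolyGrowth (fun k => c * a k) := by
  obtain ⟨C, n, h⟩ := h
  refine ⟨‖c‖ * C, n, fun k => ?_⟩
  rw [norm_mul, mul_assoc]
  exact mul_le_mul_of_nonneg_left (h k) (norm_nonneg c)

theorem succ (h : PolyGrowth a) : PolyGrowth (fun k => a (k + 1)) := by
  obtain ⟨C, n, h⟩ := h
  have hC : 0 ≤ C := by simpa using (norm_nonneg _).trans (h 0)
  refine ⟨C * 2 ^ n, n, fun k => (h (k + 1)).trans ?_⟩
  rw [mul_assoc, ← mul_pow]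
  have : (0 : ℝ) ≤ k := k.cast_nonneg
  push_cast
  gcongr
  linarith

theorem mul (ha : PolyGrowth a) (hb : PolyGrowth b) : PolyGrowth (fun k => a k * b k) := by
  obtain ⟨C, n, h⟩ := ha
  obtain ⟨D, p, h'⟩ := hb
  refine ⟨C * D, n + p, fun k => ?_⟩
  rw [norm_mul, pow_add]
  calc _ ≤ (C * ((k : ℝ) + 1) ^ n) * (D * ((k : ℝ) + 1) ^ p) :=
        mul_le_mul (h k) (h' k) (norm_nonneg _) ((norm_nonneg _).trans (h k))
    _ = _ := by ring

theorem summable_norm_mul_pow (h : PolyGrowth a) {r : ℝ} (h0 : 0 ≤ r) (h1 : r < 1) :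
    Summable (fun k => ‖a k‖ * r ^ k) := by
  obtain ⟨C, n, h⟩ := h
  -- The intermediate radius s is positive even when r = 0, so the index shift in the comparison
  -- series can be undone by dividing by s.
  obtain ⟨s, hs, hs1⟩ := exists_between h1
  have hs0 : 0 < s := h0.trans_lt hs
  have h2 := (summable_nat_add_iff 1).mpr (summable_pow_mul_geometric_of_norm_lt_one (R := ℝ) n
    (r := s) (by rwa [Real.norm_of_nonneg hs0.le]))
  refine Summable.of_nonneg_of_le (fun k => by positivity) (fun k => ?_) (h2.mul_left (C / s))
  push_cast
  have hC : 0 ≤ C := by simpa using (norm_nonneg _).trans (h 0)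
  calc ‖a k‖ * r ^ k ≤ (C * ((k : ℝ) + 1) ^ n) * s ^ k := by
        gcongr
        exact h k
    _ = _ := by
        field_simp
        ring

theorem summable (h : PolyGrowth a) {x : ℂ} (hx : ‖x‖ < 1) : Summable (fun k => a k * x ^ k) :=
  Summable.of_norm (by simpa using h.summable_norm_mul_pow (norm_nonneg x) hx)

theorem seriesSum_eq (h : PolyGrowth a) {x : ℂ} (hx : ‖x‖ < 1) :
    seriesSum a x = a 0 + x * seriesSum (fun k => a (k + 1)) x := by
  rw [seriesSum, (h.summable hx).tsum_eq_zero_add, seriesSum, ← tsum_mul_left]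
  simp only [pow_zero, mul_one]
  congr 1
  exact tsum_congr fun k => by ring

theorem differentiableOn_seriesSum (h : PolyGrowth a) :
    DifferentiableOn ℂ (seriesSum a) (Metric.ball 0 1) := by
  intro x hx
  rw [mem_ball_zero_iff] at hx
  obtain ⟨r, hr, hr1⟩ := exists_between hx
  have h0 : 0 ≤ r := (norm_nonneg x).trans hr.le
  have := Complex.differentiableOn_tsum_of_summable_norm (F := fun k x => a k * x ^ k)
    (U := Metric.ball 0 r) (h.summable_norm_mul_pow h0 hr1)
    (fun k => by fun_prop) Metric.isOpen_ball (fun k w hw => by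
      rw [mem_ball_zero_iff] at hw
      rw [norm_mul, norm_pow]
      gcongr)
  exact (this.differentiableAt (Metric.isOpen_ball.mem_nhds
    (by rwa [mem_ball_zero_iff]))).differentiableWithinAt

/-- In the variable x = -exp u, d/du is the Euler operator x d/dx, which multiplies the k-th
coefficient by k. -/
theorem hasDerivAt_seriesSum (h : PolyGrowth a) {u : ℝ} (hu : u < 0) :
    HasDerivAt (fun u : ℝ => seriesSum a (-(Real.exp u : ℂ)))
      (seriesSum (fun k => (k : ℂ) * a k) (-(Real.exp u : ℂ))) u := by
  obtain ⟨v, hv, hv0⟩ := exists_between hu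
  have hr : Real.exp v < 1 := Real.exp_lt_one_iff.mpr hv0
  have hs := h.natCast_mul.summable_norm_mul_pow (Real.exp_pos v).le hr
  refine hasDerivAt_tsum_of_isPreconnected
    (g := fun k (u : ℝ) => a k * (-(Real.exp u : ℂ)) ^ k)
    (g' := fun k (u : ℝ) => (k : ℂ) * a k * (-(Real.exp u : ℂ)) ^ k)
    hs isOpen_Iio isPreconnected_Iio (fun k y _ => ?_) (fun k y hy => ?_) hv (y := u) ?_ hv
  · have h1 : HasDerivAt (fun y : ℝ => -(Real.exp y : ℂ)) (-(Real.exp y : ℂ)) y :=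
      (Real.hasDerivAt_exp y).ofReal_comp.neg
    convert! (h1.pow k).const_mul (a k) using 1
    rcases k with _ | k
    · simp
    · simp only [Nat.add_sub_cancel]
      ring
  · rw [norm_mul, norm_pow, norm_neg, Complex.norm_real, Real.norm_of_nonneg (Real.exp_pos y).le]
    have : Real.exp y ≤ Real.exp v := Real.exp_le_exp.mpr (le_of_lt hy)
    gcongr
  · refine h.summable ?_
    rw [norm_neg, Complex.norm_real, Real.norm_of_nonneg (Real.exp_pos u).le]
    exact Real.exp_lt_one_iff.mpr hu

/-- Since u exp u → 0 at -∞, only the constant coefficient of the series multiplying the logarithm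
contributes to the singularity. -/
theorem tendsto_mul_seriesSum_sub (h : PolyGrowth a) :
    Filter.Tendsto (fun u : ℝ => (u : ℂ) * (seriesSum a (-(Real.exp u : ℂ)) - a 0))
      Filter.atBot (nhds 0) := by
  have hlim : Filter.Tendsto (fun u : ℝ => (u : ℂ) * -(Real.exp u : ℂ)) Filter.atBot (nhds 0) := by
    have h1 := (Real.tendsto_pow_mul_exp_neg_atTop_nhds_zero 1).comp Filter.tendsto_neg_atBot_atTop
    have h2 := (Complex.continuous_ofReal.tendsto 0).comp h1
    simpa [Function.comp_def] using h2
  have hcont : Filter.Tendsto (fun u : ℝ => seriesSum (fun k => a (k + 1)) (-(Real.exp u : ℂ)))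
      Filter.atBot (nhds (seriesSum (fun k => a (k + 1)) 0)) := by
    have h1 := (h.succ.differentiableOn_seriesSum.differentiableAt
      (Metric.isOpen_ball.mem_nhds (Metric.mem_ball_self one_pos))).continuousAt.tendsto
    refine h1.comp ?_
    have h2 := (Complex.continuous_ofReal.tendsto 0).comp Real.tendsto_exp_atBot
    simpa [Function.comp_def] using h2.neg
  have := hlim.mul hcont
  rw [zero_mul] at this
  refine this.congr' ?_
  filter_upwards [Filter.eventually_lt_atBot 0] with u hu
  rw [h.seriesSum_eq (by
    rw [norm_neg, Complex.norm_real, Real.norm_of_nonneg (Real.exp_pos u).le]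
    exact Real.exp_lt_one_iff.mpr hu)]
  ring

theorem tendsto_seriesSum (h : PolyGrowth a) :
    Filter.Tendsto (fun u : ℝ => seriesSum a (-(Real.exp u : ℂ))) Filter.atBot (nhds (a 0)) := by
  have h1 := (h.differentiableOn_seriesSum.differentiableAt
    (Metric.isOpen_ball.mem_nhds (Metric.mem_ball_self one_pos))).continuousAt.tendsto
  have h3 : seriesSum a 0 = a 0 := by
    rw [h.seriesSum_eq (by simp)]; simp
  rw [h3] at h1
  refine h1.comp ?_
  have h2 := (Complex.continuous_ofReal.tendsto 0).comp Real.tendsto_exp_atBot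
  simpa [Function.comp_def] using h2.neg

end PolyGrowth

/-! ### Recurrences and growth of the coefficients. -/

/-- The hypergeometric coefficient `(1/2+m)_k (1/2-m)_k / (k!)²`. -/
noncomputable def hypCoeff (m : ℤ) (k : ℕ) : ℂ :=
  (ascPochhammer ℂ k).eval (1 / 2 + (m : ℂ)) * (ascPochhammer ℂ k).eval (1 / 2 - (m : ℂ)) /
      ((k ! : ℂ) * (k ! : ℂ))

/-- The digamma part `2ψ(1+k) - ψ(1/2+m+k) - ψ(1/2-m+k)` of a coefficient. -/
noncomputable def digammaPart (m : ℤ) (k : ℕ) : ℂ :=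
  2 * Complex.digamma (1 + (k : ℂ)) - Complex.digamma (1 / 2 + (m : ℂ) + (k : ℂ))
      - Complex.digamma (1 / 2 - (m : ℂ) + (k : ℂ))

theorem half_add_int_add_nat_ne (m : ℤ) (k : ℕ) (j : ℕ) : (1 / 2 + (m : ℂ) + (k : ℂ)) ≠ -j := by
  intro h
  have h2 : ((2 * (m + k + j) + 1 : ℤ) : ℂ) = ((0 : ℤ) : ℂ) := by
    push_cast
    linear_combination 2 * h
  have := Int.cast_injective h2
  omega

theorem half_le_norm_half_add (m : ℤ) (k : ℕ) : 1 / 2 ≤ ‖(1 / 2 + (m : ℂ) + (k : ℂ))‖ := by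
  have h1 : (1 / 2 + (m : ℂ) + (k : ℂ)) = (((2 * (m + k) + 1 : ℤ) : ℝ) / 2 : ℝ) := by
    push_cast
    ring
  rw [h1, Complex.norm_real, Real.norm_eq_abs, abs_div, abs_two, ← Int.cast_abs]
  have : (1 : ℤ) ≤ |2 * (m + k) + 1| := Int.one_le_abs (by omega)
  have : ((1 : ℤ) : ℝ) ≤ (|2 * (m + k) + 1| : ℤ) := by exact_mod_cast this
  push_cast at this ⊢
  linarith

theorem hypCoeff_zero (m : ℤ) : hypCoeff m 0 = 1 := by simp [hypCoeff]

theorem hypCoeff_succ (m : ℤ) (k : ℕ) :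
    ((k : ℂ) + 1) ^ 2 * hypCoeff m (k + 1) = (((k : ℂ) + 1 / 2) ^ 2 - (m : ℂ) ^ 2) * hypCoeff m k := by
  have h1 : (k : ℂ) + 1 ≠ 0 := by exact_mod_cast k.succ_ne_zero
  have h2 : (k ! : ℂ) ≠ 0 := by exact_mod_cast k.factorial_ne_zero
  simp only [hypCoeff, ascPochhammer_succ_eval, Nat.factorial_succ]
  push_cast
  field_simp
  ring

theorem digammaPart_succ (m : ℤ) (k : ℕ) :
    digammaPart m (k + 1) = digammaPart m k + 2 / ((k : ℂ) + 1) - 1 / (1 / 2 + (m : ℂ) + k)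
      - 1 / (1 / 2 - (m : ℂ) + k) := by
  have e1 := Complex.digamma_apply_add_one (1 + (k : ℂ)) (fun j h => by
    have : ((1 + k + j : ℕ) : ℂ) = ((0 : ℕ) : ℂ) := by
      push_cast
      linear_combination h
    have := Nat.cast_injective this
    omega)
  have e2 := Complex.digamma_apply_add_one _ (half_add_int_add_nat_ne m k)
  have e3 := Complex.digamma_apply_add_one (1 / 2 - (m : ℂ) + k) (by
    have := half_add_int_add_nat_ne (-m) k
    push_cast at this
    simpa [sub_eq_add_neg] using this)
  simp only [digammaPart]
  push_cast
  rw [← add_assoc, e1, ← add_assoc, e2, ← add_assoc, e3]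
  ring

theorem half_add_mul_half_sub_ne_zero (m : ℤ) (k : ℕ) :
    (1 / 2 + (m : ℂ) + k) ≠ 0 ∧ (1 / 2 - (m : ℂ) + k) ≠ 0 := by
  have h1 := half_add_int_add_nat_ne m k 0
  have h2 := half_add_int_add_nat_ne (-m) k 0
  push_cast at h2
  simpa [sub_eq_add_neg] using And.intro h1 h2

/-- Each of the three terms of the increment has norm at most 2, because a half-integer has absolute
value at least 1/2; hence the growth is linear. -/
theorem polyGrowth_digammaPart (m : ℤ) : PolyGrowth (digammaPart m) := by
  refine ⟨‖digammaPart m 0‖ + 6, 1, fun k => ?_⟩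
  have key : ‖digammaPart m k‖ ≤ ‖digammaPart m 0‖ + 6 * k := by
    induction k with
    | zero => simp
    | succ k ih =>
      rw [digammaPart_succ]
      have h1 : ‖2 / ((k : ℂ) + 1)‖ ≤ 2 := by
        have : (k : ℂ) + 1 = ((k + 1 : ℕ) : ℂ) := by push_cast; rfl
        rw [norm_div, this, Complex.norm_natCast, Complex.norm_ofNat]
        push_cast
        rw [div_le_iff₀ (by positivity)]
        have : (0 : ℝ) ≤ k := k.cast_nonneg
        linarith
      have h2 : ∀ m : ℤ, ‖1 / (1 / 2 + (m : ℂ) + k)‖ ≤ 2 := fun m => by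
        have := half_le_norm_half_add m k
        rw [norm_div, norm_one, div_le_iff₀ (by linarith)]
        linarith
      have h3 := h2 m
      have h4 := h2 (-m)
      push_cast at h4
      rw [← sub_eq_add_neg] at h4
      push_cast
      have := norm_sub_le (digammaPart m k + 2 / ((k : ℂ) + 1) - 1 / (1 / 2 + (m : ℂ) + k))
        (1 / (1 / 2 - (m : ℂ) + k))
      have := norm_sub_le (digammaPart m k + 2 / ((k : ℂ) + 1)) (1 / (1 / 2 + (m : ℂ) + k))
      have := norm_add_le (digammaPart m k) (2 / ((k : ℂ) + 1))
      linarith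
  have : (0 : ℝ) ≤ k := k.cast_nonneg
  nlinarith [norm_nonneg (digammaPart m 0)]

/-- Once k ≥ m², |(k + 1/2)² - m²| ≤ (k + 1)², so the norms are eventually nonincreasing and the
sequence is bounded. -/
theorem polyGrowth_hypCoeff (m : ℤ) : PolyGrowth (hypCoeff m) := by
  obtain ⟨N, hN⟩ := exists_nat_ge ((m : ℝ) ^ 2)
  have step : ∀ k, N ≤ k → ‖hypCoeff m (k + 1)‖ ≤ ‖hypCoeff m k‖ := by
    intro k hk
    have h1 := congrArg norm (hypCoeff_succ m k)
    have e1 : (k : ℂ) + 1 = (((k : ℝ) + 1 : ℝ) : ℂ) := by push_cast; rfl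
    have e2 : ((k : ℂ) + 1 / 2) ^ 2 - (m : ℂ) ^ 2 = ((((k : ℝ) + 1 / 2) ^ 2 - (m : ℝ) ^ 2 : ℝ) : ℂ) := by
      push_cast; rfl
    rw [e1, e2, norm_mul, norm_mul, norm_pow, Complex.norm_real, Complex.norm_real,
      Real.norm_of_nonneg (by positivity), Real.norm_eq_abs] at h1
    have hk' : (N : ℝ) ≤ k := by exact_mod_cast hk
    have h2 : |((k : ℝ) + 1 / 2) ^ 2 - (m : ℝ) ^ 2| ≤ ((k : ℝ) + 1) ^ 2 := by
      rw [abs_le]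
      constructor <;> nlinarith [sq_nonneg (m : ℝ)]
    have h3 : ((k : ℝ) + 1) ^ 2 * ‖hypCoeff m (k + 1)‖ ≤ ((k : ℝ) + 1) ^ 2 * ‖hypCoeff m k‖ := by
      rw [h1]
      exact mul_le_mul_of_nonneg_right h2 (norm_nonneg _)
    exact le_of_mul_le_mul_left h3 (by positivity)
  refine ⟨∑ k ∈ Finset.range (N + 1), ‖hypCoeff m k‖, 0, fun k => ?_⟩
  rw [pow_zero, mul_one]
  have small : ∀ k, k ≤ N → ‖hypCoeff m k‖ ≤ ∑ k ∈ Finset.range (N + 1), ‖hypCoeff m k‖ :=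
    fun k hk => Finset.single_le_sum (f := fun k => ‖hypCoeff m k‖) (fun _ _ => norm_nonneg _)
      (Finset.mem_range.mpr (by omega))
  rcases le_total k N with h | h
  · exact small k h
  · induction k, h using Nat.le_induction with
    | base => exact small N le_rfl
    | succ k hk ih => exact (step k hk).trans ih

theorem diagonalTerm_eq (m : ℤ) (w L : ℂ) (k : ℕ) :
    diagonalTerm m w L k = hypCoeff m k * digammaPart m k * w ^ k - hypCoeff m k * w ^ k * L := by
  simp only [diagonalTerm, hypCoeff, digammaPart]
  ring

theorem hasSum_diagonalTerm (m : ℤ) {w : ℂ} (hw : ‖w‖ < 1) (L : ℂ) :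
    HasSum (diagonalTerm m w L)
      (seriesSum (fun k => hypCoeff m k * digammaPart m k) w - seriesSum (hypCoeff m) w * L) := by
  have h1 := (((polyGrowth_hypCoeff m).mul (polyGrowth_digammaPart m)).summable hw).hasSum
  have h2 := ((polyGrowth_hypCoeff m).summable hw).hasSum.mul_right L
  rw [funext (diagonalTerm_eq m w L)]
  exact h1.sub h2

/-! ### The differential equation and uniqueness of solutions at -∞. -/

/-- `y` solves, on the negative half-line, the hypergeometric equation with parameters
`1/2 + m, 1/2 - m; 1` in the variable `-exp u`; `y₁` and `y₂` are its first two derivatives. -/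
structure IsLegendreSolution (m : ℤ) (y y₁ y₂ : ℝ → ℂ) : Prop where
  hasDerivAt : ∀ u < 0, HasDerivAt y (y₁ u) u
  hasDerivAt_deriv : ∀ u < 0, HasDerivAt y₁ (y₂ u) u
  equation : ∀ u < 0,
    y₂ u + (Real.exp u : ℂ) * (y₂ u + y₁ u + (1 / 4 - (m : ℂ) ^ 2) * y u) = 0

theorem eq_zero_of_hasDerivAt_zero_of_tendsto_atBot {f : ℝ → ℂ} {v : ℝ}
    (hf : ∀ u < v, HasDerivAt f 0 u) (hlim : Filter.Tendsto f Filter.atBot (nhds 0)) :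
    ∀ u < v, f u = 0 := by
  intro u hu
  have hconst : ∀ x < v, f x = f u := fun x hx =>
    isOpen_Iio.is_const_of_deriv_eq_zero isPreconnected_Iio
      (fun y hy => (hf y hy).differentiableAt.differentiableWithinAt)
      (fun y hy => (hf y hy).deriv) hx hu
  have h1 : Filter.Tendsto f Filter.atBot (nhds (f u)) :=
    tendsto_const_nhds.congr' (by
      filter_upwards [Filter.eventually_lt_atBot v] with x hx using (hconst x hx).symm)
  exact tendsto_nhds_unique h1 hlim

namespace IsLegendreSolution

variable {m : ℤ} {y y₁ y₂ z z₁ z₂ : ℝ → ℂ}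

theorem sub (hy : IsLegendreSolution m y y₁ y₂) (hz : IsLegendreSolution m z z₁ z₂) :
    IsLegendreSolution m (fun u => y u - z u) (fun u => y₁ u - z₁ u) (fun u => y₂ u - z₂ u) where
  hasDerivAt u hu := (hy.hasDerivAt u hu).sub (hz.hasDerivAt u hu)
  hasDerivAt_deriv u hu := (hy.hasDerivAt_deriv u hu).sub (hz.hasDerivAt_deriv u hu)
  equation u hu := by linear_combination hy.equation u hu - hz.equation u hu

/-- Abel's identity: in (1 + eᵘ)y'' + eᵘy' + ⋯ = 0 the weight 1 + eᵘ is the integrating factor for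
the Wronskian. -/
theorem wronskian_hasDerivAt (hy : IsLegendreSolution m y y₁ y₂)
    (hz : IsLegendreSolution m z z₁ z₂) {u : ℝ} (hu : u < 0) :
    HasDerivAt (fun u => (1 + (Real.exp u : ℂ)) * (y u * z₁ u - y₁ u * z u)) 0 u := by
  have he := (Real.hasDerivAt_exp u).ofReal_comp.const_add (1 : ℂ)
  have h1 := (hy.hasDerivAt u hu).mul (hz.hasDerivAt_deriv u hu)
  have h2 := (hy.hasDerivAt_deriv u hu).mul (hz.hasDerivAt u hu)
  refine (he.mul (h1.sub h2)).congr_deriv ?_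
  simp only [Pi.sub_apply, Pi.mul_apply]
  linear_combination y u * hz.equation u hu - z u * hy.equation u hu

/-- A solution vanishing with its derivative at `-∞` vanishes near `-∞`, given a solution tending
to `1`. -/
theorem eventually_eq_zero (hy : IsLegendreSolution m y y₁ y₂)
    (hz : IsLegendreSolution m z z₁ z₂) (hy0 : Filter.Tendsto y Filter.atBot (nhds 0))
    (hy1 : Filter.Tendsto y₁ Filter.atBot (nhds 0)) (hz0 : Filter.Tendsto z Filter.atBot (nhds 1))
    (hz1 : Filter.Tendsto z₁ Filter.atBot (nhds 0)) : ∀ᶠ u in Filter.atBot, y u = 0 := by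
  have hexp : Filter.Tendsto (fun u : ℝ => (Real.exp u : ℂ)) Filter.atBot (nhds 0) := by
    simpa [Function.comp_def] using
      (Complex.continuous_ofReal.tendsto 0).comp Real.tendsto_exp_atBot
  have hW := eq_zero_of_hasDerivAt_zero_of_tendsto_atBot
    (fun u hu => hy.wronskian_hasDerivAt hz hu) (by
      simpa using (hexp.const_add 1).mul ((hy0.mul hz1).sub (hy1.mul hz0)))
  have hne : ∀ᶠ u in Filter.atBot, z u ≠ 0 := hz0.eventually_ne one_ne_zero
  obtain ⟨v, hv⟩ := Filter.eventually_atBot.mp (hne.and (Filter.eventually_lt_atBot 0))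
  -- The vanishing Wronskian is the numerator of (y/z)'. The quotient is used only near -∞, where z,
  -- being close to 1, has no zeros.
  have hq := eq_zero_of_hasDerivAt_zero_of_tendsto_atBot (f := fun u => y u / z u) (v := v)
    (fun u hu => by
      obtain ⟨hzu, hu0⟩ := hv u hu.le
      refine ((hy.hasDerivAt u hu0).div (hz.hasDerivAt u hu0) hzu).congr_deriv ?_
      have h := hW u hu0
      have hpos : (1 + (Real.exp u : ℂ)) ≠ 0 := by
        exact_mod_cast (by positivity : (1 + Real.exp u) ≠ 0)
      have h' := (mul_eq_zero.mp h).resolve_left hpos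
      rw [div_eq_zero_iff]
      left
      linear_combination -h') (by simpa [Pi.div_def] using hy0.div hz0 one_ne_zero)
  filter_upwards [Filter.eventually_lt_atBot v] with u hu
  exact (div_eq_zero_iff.mp (hq u hu)).resolve_right (hv u hu.le).1

end IsLegendreSolution

/-! ### Frobenius series with a logarithm. -/

/-- The logarithmic series with coefficients `d k - a k * u` at `-exp u`, as a function of `u`. -/
noncomputable def logSeries (a d : ℕ → ℂ) (u : ℝ) : ℂ :=
  seriesSum d (-(Real.exp u : ℂ)) - seriesSum a (-(Real.exp u : ℂ)) * u

theorem norm_neg_exp_lt_one {u : ℝ} (hu : u < 0) : ‖-(Real.exp u : ℂ)‖ < 1 := by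
  rw [norm_neg, Complex.norm_real, Real.norm_of_nonneg (Real.exp_pos u).le]
  exact Real.exp_lt_one_iff.mpr hu

namespace PolyGrowth

variable {a d : ℕ → ℂ}

theorem add {b : ℕ → ℂ} (ha : PolyGrowth a) (hb : PolyGrowth b) :
    PolyGrowth (fun k => a k + b k) := by
  obtain ⟨C, n, h⟩ := ha
  obtain ⟨D, p, h'⟩ := hb
  have hC : 0 ≤ C := by simpa using (norm_nonneg _).trans (h 0)
  have hD : 0 ≤ D := by simpa using (norm_nonneg _).trans (h' 0)
  refine ⟨C + D, n + p, fun k => (norm_add_le _ _).trans ?_⟩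
  have h1 : (1 : ℝ) ≤ (k : ℝ) + 1 := by linarith [(Nat.cast_nonneg k : (0 : ℝ) ≤ k)]
  have e1 := pow_le_pow_right₀ h1 (Nat.le_add_right n p)
  have e2 := pow_le_pow_right₀ h1 (Nat.le_add_left p n)
  have := h k
  have := h' k
  nlinarith [mul_le_mul_of_nonneg_left e1 hC, mul_le_mul_of_nonneg_left e2 hD]

theorem sub {b : ℕ → ℂ} (ha : PolyGrowth a) (hb : PolyGrowth b) :
    PolyGrowth (fun k => a k - b k) := by
  simpa [sub_eq_add_neg] using ha.add (hb.const_mul (-1))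

theorem seriesSum_sub {b : ℕ → ℂ} (ha : PolyGrowth a) (hb : PolyGrowth b) {x : ℂ}
    (hx : ‖x‖ < 1) : seriesSum (fun k => a k - b k) x = seriesSum a x - seriesSum b x := by
  rw [seriesSum, seriesSum, seriesSum, ← (ha.summable hx).tsum_sub (hb.summable hx)]
  exact tsum_congr fun k => by ring

theorem hasDerivAt_logSeries (ha : PolyGrowth a) (hd : PolyGrowth d) {u : ℝ} (hu : u < 0) :
    HasDerivAt (logSeries a d)
      (logSeries (fun k => (k : ℂ) * a k) (fun k => (k : ℂ) * d k - a k) u) u := by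
  have h1 := (hd.hasDerivAt_seriesSum hu).sub
    ((ha.hasDerivAt_seriesSum hu).mul (hasDerivAt_id u).ofReal_comp)
  refine h1.congr_deriv ?_
  rw [logSeries, hd.natCast_mul.seriesSum_sub ha (norm_neg_exp_lt_one hu)]
  simp
  ring

theorem logSeries_eq (ha : PolyGrowth a) (hd : PolyGrowth d) {u : ℝ} (hu : u < 0) :
    HasSum (fun k => (d k - a k * u) * (-(Real.exp u : ℂ)) ^ k) (logSeries a d u) := by
  have h1 := (hd.summable (norm_neg_exp_lt_one hu)).hasSum
  have h2 := ((ha.summable (norm_neg_exp_lt_one hu)).hasSum).mul_right (u : ℂ)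
  refine (h1.sub h2).congr_fun ?_
  intro k
  ring

/-- `logSeries a d` is a solution when its coefficients satisfy the Frobenius recurrences. -/
theorem isLegendreSolution_logSeries {m : ℤ} (ha : PolyGrowth a) (hd : PolyGrowth d)
    (hrec : ∀ k : ℕ, ((k : ℂ) + 1) ^ 2 * a (k + 1) = (((k : ℂ) + 1 / 2) ^ 2 - (m : ℂ) ^ 2) * a k)
    (hrec' : ∀ k : ℕ, ((k : ℂ) + 1) ^ 2 * d (k + 1) - 2 * ((k : ℂ) + 1) * a (k + 1) =
      (((k : ℂ) + 1 / 2) ^ 2 - (m : ℂ) ^ 2) * d k - (2 * (k : ℂ) + 1) * a k) :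
    IsLegendreSolution m (logSeries a d)
      (logSeries (fun k => (k : ℂ) * a k) (fun k => (k : ℂ) * d k - a k))
      (logSeries (fun k => (k : ℂ) * ((k : ℂ) * a k))
        (fun k => (k : ℂ) * ((k : ℂ) * d k - a k) - (k : ℂ) * a k)) where
  hasDerivAt u hu := ha.hasDerivAt_logSeries hd hu
  hasDerivAt_deriv u hu := ha.natCast_mul.hasDerivAt_logSeries (hd.natCast_mul.sub ha) hu
  equation u hu := by
    have h0 := ha.logSeries_eq hd hu
    have h1 := ha.natCast_mul.logSeries_eq (hd.natCast_mul.sub ha) hu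
    have h2 := ha.natCast_mul.natCast_mul.logSeries_eq
      ((hd.natCast_mul.sub ha).natCast_mul.sub ha.natCast_mul) hu
    have h3 := ((h2.add h1).add (h0.mul_left (1 / 4 - (m : ℂ) ^ 2))).mul_left (-(Real.exp u : ℂ))
    -- The k = 0 term of the second-derivative series is zero. Dropping it shifts the index by one,
    -- which matches multiplication by -exp u on the other side.
    have h4 := (hasSum_nat_add_iff' 1).mpr h2
    have h5 := h4.unique (h3.congr_fun fun k => by
      simp only [Nat.cast_add, Nat.cast_one]
      linear_combination (-(Real.exp u : ℂ)) ^ (k + 1) * (hrec' k - (u : ℂ) * hrec k))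
    simp only [Finset.range_one, Finset.sum_singleton, Nat.cast_zero, zero_mul, sub_zero] at h5
    linear_combination h5

end PolyGrowth

/-! ### The quarter-period integral and its differential equation. -/

/-- The integral of `cos (2ma) (t + sin² a)^q` over a quarter period. -/
noncomputable def quarterIntegral (m : ℤ) (q t : ℝ) : ℝ :=
  ∫ a in (0 : ℝ)..Real.pi / 2, Real.cos (2 * m * a) * (t + Real.sin a ^ 2) ^ q

theorem add_sin_sq_pos {t : ℝ} (ht : 0 < t) (a : ℝ) : 0 < t + Real.sin a ^ 2 := by positivity

theorem continuous_add_sin_sq_rpow {t : ℝ} (ht : 0 < t) (q : ℝ) :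
    Continuous (fun a : ℝ => (t + Real.sin a ^ 2) ^ q) :=
  (by fun_prop : Continuous fun a : ℝ => t + Real.sin a ^ 2).rpow_const
    fun a => Or.inl (add_sin_sq_pos ht a).ne'

theorem hasDerivAt_quarterIntegral (m : ℤ) (q : ℝ) {t : ℝ} (ht : 0 < t) :
    HasDerivAt (quarterIntegral m q) (q * quarterIntegral m (q - 1) t) t := by
  have hs : Set.Ioo (t / 2) (2 * t) ∈ nhds t := Ioo_mem_nhds (by linarith) (by linarith)
  have hcont : ContinuousOn
      (fun p : ℝ × ℝ => Real.cos (2 * m * p.2) * (q * (p.1 + Real.sin p.2 ^ 2) ^ (q - 1)))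
      (Set.Icc (t / 2) (2 * t) ×ˢ Set.Icc 0 (Real.pi / 2)) := by
    refine ContinuousOn.mul (by fun_prop) (continuousOn_const.mul
      (ContinuousOn.rpow_const (by fun_prop) fun p hp => Or.inl ?_))
    exact (add_sin_sq_pos (by linarith [hp.1.1]) _).ne'
  obtain ⟨C, hC⟩ := (isCompact_Icc.prod isCompact_Icc).exists_bound_of_continuousOn hcont
  have := (intervalIntegral.hasDerivAt_integral_of_dominated_loc_of_deriv_le (μ := MeasureTheory.volume)
    (F := fun t a => Real.cos (2 * m * a) * (t + Real.sin a ^ 2) ^ q)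
    (F' := fun t a => Real.cos (2 * m * a) * (q * (t + Real.sin a ^ 2) ^ (q - 1)))
    (x₀ := t) (a := 0) (b := Real.pi / 2) (bound := fun _ => C) hs ?_ ?_ ?_ ?_ ?_ ?_).2
  · refine this.congr_deriv ?_
    rw [quarterIntegral, ← intervalIntegral.integral_const_mul]
    congr 1
    ext a
    ring
  · filter_upwards [hs] with x hx
    exact ((by fun_prop : Continuous fun a : ℝ => Real.cos (2 * m * a)).mul
      (continuous_add_sin_sq_rpow (by linarith [hx.1]) q)).aestronglyMeasurable
  · exact ((by fun_prop : Continuous fun a : ℝ => Real.cos (2 * m * a)).mul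
      (continuous_add_sin_sq_rpow ht q)).intervalIntegrable _ _
  · exact ((by fun_prop : Continuous fun a : ℝ => Real.cos (2 * m * a)).mul
      (continuous_const.mul (continuous_add_sin_sq_rpow ht (q - 1)))).aestronglyMeasurable
  · refine Filter.Eventually.of_forall fun a ha x hx => ?_
    rw [Set.uIoc_of_le (by positivity)] at ha
    exact hC (x, a) ⟨⟨hx.1.le, hx.2.le⟩, ha.1.le, ha.2⟩
  · exact intervalIntegrable_const
  · refine Filter.Eventually.of_forall fun a _ x hx => ?_
    have hx0 : 0 < id x := (half_pos ht).trans hx.1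
    have h1 := (((hasDerivAt_id x).add_const (Real.sin a ^ 2)).rpow_const (p := q)
      (Or.inl (add_sin_sq_pos hx0 a).ne')).const_mul (Real.cos (2 * m * a))
    refine h1.congr_deriv ?_
    simp

theorem hasDerivAt_add_sin_sq_rpow {t : ℝ} (ht : 0 < t) (q a : ℝ) :
    HasDerivAt (fun a => (t + Real.sin a ^ 2) ^ q)
      (2 * Real.sin a * Real.cos a * q * (t + Real.sin a ^ 2) ^ (q - 1)) a := by
  have h1 := (((Real.hasDerivAt_sin a).pow 2).const_add t).rpow_const (p := q)
    (Or.inl (add_sin_sq_pos ht a).ne')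
  refine h1.congr_deriv ?_
  simp

theorem rpow_add_nat_eq {x : ℝ} (hx : 0 < x) (q p : ℝ) (n : ℕ) (h : q = p + n) :
    x ^ q = x ^ n * x ^ p := by
  rw [h, Real.rpow_add_natCast hx.ne']
  ring

/-- The combined integrand is an exact derivative, of a function that vanishes at 0 and π/2 because
sin(mπ) = 0 and sin · cos vanishes at both ends. After t = exp u this is the hypergeometric
equation. -/
theorem quarterIntegral_relation (m : ℤ) {t : ℝ} (ht : 0 < t) :
    3 / 4 * t * (1 + t) * quarterIntegral m (-5 / 2) t
      - 1 / 2 * (1 + 2 * t) * quarterIntegral m (-3 / 2) t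
      + (1 / 4 - (m : ℝ) ^ 2) * quarterIntegral m (-1 / 2) t = 0 := by
  have hc : ∀ q : ℝ, IntervalIntegrable
      (fun a : ℝ => Real.cos (2 * m * a) * (t + Real.sin a ^ 2) ^ q) MeasureTheory.volume
      0 (Real.pi / 2) := fun q =>
    ((by fun_prop : Continuous fun a : ℝ => Real.cos (2 * m * a)).mul
      (continuous_add_sin_sq_rpow ht q)).intervalIntegrable _ _
  have hderiv : ∀ a : ℝ, HasDerivAt (fun a => -((m : ℝ) / 2 * Real.sin (2 * m * a) *
        (t + Real.sin a ^ 2) ^ (-1 / 2 : ℝ)) + 1 / 4 * (Real.cos (2 * m * a) *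
        (Real.sin a * Real.cos a * (t + Real.sin a ^ 2) ^ (-3 / 2 : ℝ))))
      (3 / 4 * t * (1 + t) * (Real.cos (2 * m * a) * (t + Real.sin a ^ 2) ^ (-5 / 2 : ℝ))
      - 1 / 2 * (1 + 2 * t) * (Real.cos (2 * m * a) * (t + Real.sin a ^ 2) ^ (-3 / 2 : ℝ))
      + (1 / 4 - (m : ℝ) ^ 2) * (Real.cos (2 * m * a) * (t + Real.sin a ^ 2) ^ (-1 / 2 : ℝ))) a := by
    intro a
    have hQ := add_sin_sq_pos ht a
    have hl : HasDerivAt (fun a : ℝ => 2 * (m : ℝ) * a) (2 * m) a := by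
      simpa using (hasDerivAt_id a).const_mul (2 * (m : ℝ))
    have h1 := ((hl.sin.const_mul ((m : ℝ) / 2)).mul (hasDerivAt_add_sin_sq_rpow ht (-1 / 2) a)).neg
    have h2 := (hl.cos.mul (((Real.hasDerivAt_sin a).mul (Real.hasDerivAt_cos a)).mul
      (hasDerivAt_add_sin_sq_rpow ht (-3 / 2) a))).const_mul (1 / 4)
    refine (h1.add h2).congr_deriv ?_
    rw [show (-1 / 2 - 1 : ℝ) = -3 / 2 by norm_num, show (-3 / 2 - 1 : ℝ) = -5 / 2 by norm_num]
    simp only [Pi.mul_apply]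
    -- Writing every power through the exponent -5/2 leaves a polynomial identity in the sines and
    -- cosines.
    rw [rpow_add_nat_eq hQ (-3 / 2) (-5 / 2) 1 (by norm_num),
      rpow_add_nat_eq hQ (-1 / 2) (-5 / 2) 2 (by norm_num)]
    generalize (t + Real.sin a ^ 2) ^ (-5 / 2 : ℝ) = X
    have hsc := Real.sin_sq_add_cos_sq a
    have hcos : Real.cos a ^ 2 = 1 - Real.sin a ^ 2 := by linarith
    ring_nf
    simp only [hcos]
    ring
  have hint := intervalIntegral.integral_eq_sub_of_hasDerivAt (a := 0) (b := Real.pi / 2)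
    (fun a _ => hderiv a)
    ((((hc _).const_mul _).sub ((hc _).const_mul _)).add ((hc _).const_mul _))
  rw [intervalIntegral.integral_add (((hc _).const_mul _).sub ((hc _).const_mul _))
    ((hc _).const_mul _), intervalIntegral.integral_sub ((hc _).const_mul _) ((hc _).const_mul _),
    intervalIntegral.integral_const_mul, intervalIntegral.integral_const_mul,
    intervalIntegral.integral_const_mul] at hint
  have hsin : Real.sin (2 * m * (Real.pi / 2)) = 0 := by
    rw [show 2 * (m : ℝ) * (Real.pi / 2) = m * Real.pi by ring]
    exact Real.sin_int_mul_pi m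
  simp only [hsin, Real.cos_pi_div_two, mul_zero, Real.sin_zero, zero_mul, neg_zero, add_zero,
    sub_zero] at hint
  exact hint

/-- The quarter-period integral with exponent `-1/2` as a function of `u = log t`. -/
noncomputable def diagonalIntegral (m : ℤ) (u : ℝ) : ℂ :=
  ((2 * quarterIntegral m (-1 / 2) (Real.exp u) : ℝ) : ℂ)

theorem isLegendreSolution_diagonalIntegral (m : ℤ) :
    IsLegendreSolution m (diagonalIntegral m)
      (fun u => ((-(Real.exp u * quarterIntegral m (-3 / 2) (Real.exp u)) : ℝ) : ℂ))
      (fun u => ((-(Real.exp u * quarterIntegral m (-3 / 2) (Real.exp u)) +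
        3 / 2 * Real.exp u ^ 2 * quarterIntegral m (-5 / 2) (Real.exp u) : ℝ) : ℂ)) where
  hasDerivAt u _ := by
    have h := ((hasDerivAt_quarterIntegral m (-1 / 2) (Real.exp_pos u)).comp u
      (Real.hasDerivAt_exp u)).const_mul 2
    refine (h.congr_deriv ?_).ofReal_comp
    rw [show (-1 / 2 - 1 : ℝ) = -3 / 2 by norm_num]
    ring
  hasDerivAt_deriv u _ := by
    have h := ((Real.hasDerivAt_exp u).mul
      ((hasDerivAt_quarterIntegral m (-3 / 2) (Real.exp_pos u)).comp u
      (Real.hasDerivAt_exp u))).neg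
    refine (h.congr_deriv ?_).ofReal_comp
    rw [show (-3 / 2 - 1 : ℝ) = -5 / 2 by norm_num]
    simp only [Function.comp_apply]
    ring
  equation u _ := by
    have h := congrArg (fun x : ℝ => (x : ℂ)) (quarterIntegral_relation m (Real.exp_pos u))
    simp only [diagonalIntegral]
    simp only [Complex.ofReal_add, Complex.ofReal_sub, Complex.ofReal_mul, Complex.ofReal_pow,
      Complex.ofReal_neg, Complex.ofReal_div, Complex.ofReal_one, Complex.ofReal_ofNat,
      Complex.ofReal_intCast, Complex.ofReal_zero] at h ⊢
    linear_combination 2 * (Real.exp u : ℂ) * h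

/-! ### Behaviour of the quarter-period integrals as t → 0+. -/

/-- The factor sin a in g cancels the singularity 1/sin a of the limiting kernel, so the constant 2
dominates. -/
theorem tendsto_integral_mul_add_sin_sq_rpow {g h : ℝ → ℝ} (hg : Continuous g)
    (hbound : ∀ a ∈ Set.Ioc 0 (Real.pi / 2), |g a| ≤ 2 * Real.sin a)
    (hh : ∀ a ∈ Set.Ioc 0 (Real.pi / 2), g a = h a * Real.sin a) :
    Filter.Tendsto (fun t : ℝ => ∫ a in (0 : ℝ)..Real.pi / 2, g a * (t + Real.sin a ^ 2) ^ (-1 / 2 : ℝ))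
      (nhdsWithin 0 (Set.Ioi 0)) (nhds (∫ a in (0 : ℝ)..Real.pi / 2, h a)) := by
  have hpos : ∀ a ∈ Set.Ioc 0 (Real.pi / 2), 0 < Real.sin a := fun a ha =>
    Real.sin_pos_of_pos_of_lt_pi ha.1 (by linarith [ha.2, Real.pi_pos])
  refine intervalIntegral.tendsto_integral_filter_of_dominated_convergence (fun _ => 2) ?_ ?_ ?_ ?_
  · filter_upwards [self_mem_nhdsWithin] with t ht
    exact (hg.mul (continuous_add_sin_sq_rpow ht _)).aestronglyMeasurable
  · filter_upwards [self_mem_nhdsWithin] with t ht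
    refine Filter.Eventually.of_forall fun a ha => ?_
    rw [Set.uIoc_of_le (by positivity)] at ha
    have hs := hpos a ha
    have h1 : (t + Real.sin a ^ 2) ^ (-1 / 2 : ℝ) ≤ (Real.sin a ^ 2) ^ (-1 / 2 : ℝ) :=
      Real.rpow_le_rpow_of_nonpos (by positivity) (by linarith [Set.mem_Ioi.mp ht]) (by norm_num)
    have h2 : (Real.sin a ^ 2) ^ (-1 / 2 : ℝ) = (Real.sin a)⁻¹ := by
      rw [← Real.rpow_natCast, ← Real.rpow_mul hs.le, ← Real.rpow_neg_one]
      norm_num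
    have h3 : 0 ≤ (t + Real.sin a ^ 2) ^ (-1 / 2 : ℝ) :=
      Real.rpow_nonneg (add_sin_sq_pos ht a).le _
    rw [norm_mul, Real.norm_eq_abs, Real.norm_of_nonneg h3]
    calc _ ≤ (2 * Real.sin a) * (Real.sin a)⁻¹ :=
          mul_le_mul (hbound a ha) (h1.trans h2.le) h3 (by positivity)
      _ = 2 := by field_simp
  · exact intervalIntegrable_const
  · refine Filter.Eventually.of_forall fun a ha => ?_
    rw [Set.uIoc_of_le (by positivity)] at ha
    have hs := hpos a ha
    have h2 : (Real.sin a ^ 2) ^ (-1 / 2 : ℝ) = (Real.sin a)⁻¹ := by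
      rw [← Real.rpow_natCast, ← Real.rpow_mul hs.le, ← Real.rpow_neg_one]
      norm_num
    have h4 : Filter.Tendsto (fun t : ℝ => t + Real.sin a ^ 2) (nhdsWithin 0 (Set.Ioi 0))
        (nhds (Real.sin a ^ 2)) := by
      have : Filter.Tendsto (fun t : ℝ => t + Real.sin a ^ 2) (nhds 0) (nhds (0 + Real.sin a ^ 2)) :=
        (by fun_prop : Continuous fun t : ℝ => t + Real.sin a ^ 2).tendsto 0
      rw [zero_add] at this
      exact this.mono_left nhdsWithin_le_nhds
    have h5 := (h4.rpow_const (p := -1 / 2) (Or.inl (by positivity))).const_mul (g a)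
    rw [h2, hh a ha, mul_assoc, mul_inv_cancel₀ hs.ne', mul_one] at h5
    simpa only [hh a ha] using h5

theorem integral_sin_odd_mul (m : ℕ) :
    ∫ a in (0 : ℝ)..Real.pi / 2, -2 * Real.sin ((2 * m + 1) * a) = -2 / (2 * m + 1) := by
  have h0 : (2 * m + 1 : ℝ) ≠ 0 := by positivity
  have hcos : Real.cos ((2 * m + 1) * (Real.pi / 2)) = 0 := by
    rw [Real.cos_eq_zero_iff]
    exact ⟨m, by push_cast; ring⟩
  rw [intervalIntegral.integral_const_mul, intervalIntegral.integral_comp_mul_left (hc := h0)]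
  simp [hcos]
  ring

/-- The difference cos(2(m+1)a) - cos(2ma) = -2 sin((2m+1)a) sin a carries the factor that removes
the logarithmic singularity. -/
theorem tendsto_quarterIntegral_succ_sub (m : ℕ) :
    Filter.Tendsto (fun t : ℝ => 2 * quarterIntegral (m + 1) (-1 / 2) t
        - 2 * quarterIntegral m (-1 / 2) t)
      (nhdsWithin 0 (Set.Ioi 0)) (nhds (-4 / (2 * m + 1))) := by
  have h := (tendsto_integral_mul_add_sin_sq_rpow
    (g := fun a => -2 * Real.sin ((2 * m + 1) * a) * Real.sin a)
    (h := fun a => -2 * Real.sin ((2 * m + 1) * a)) (by fun_prop) (fun a ha => by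
      have hs : 0 < Real.sin a :=
        Real.sin_pos_of_pos_of_lt_pi ha.1 (by linarith [ha.2, Real.pi_pos])
      rw [abs_mul, abs_mul, abs_of_pos hs, abs_neg, abs_two]
      have := Real.abs_sin_le_one ((2 * m + 1) * a)
      nlinarith) (fun a _ => rfl)).const_mul 2
  rw [integral_sin_odd_mul] at h
  rw [show (-4 / (2 * m + 1) : ℝ) = 2 * (-2 / (2 * m + 1)) by ring]
  refine h.congr' ?_
  filter_upwards [self_mem_nhdsWithin] with t ht
  have hc : ∀ m : ℤ, IntervalIntegrable
      (fun a : ℝ => Real.cos (2 * m * a) * (t + Real.sin a ^ 2) ^ (-1 / 2 : ℝ))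
      MeasureTheory.volume 0 (Real.pi / 2) := fun m =>
    ((by fun_prop : Continuous fun a : ℝ => Real.cos (2 * m * a)).mul
      (continuous_add_sin_sq_rpow ht _)).intervalIntegrable _ _
  rw [← mul_sub, quarterIntegral, quarterIntegral, ← intervalIntegral.integral_sub (hc _) (hc _)]
  congr 1
  refine intervalIntegral.integral_congr fun a _ => ?_
  push_cast
  have e1 := Real.cos_add ((2 * m + 1) * a) a
  have e2 := Real.cos_sub ((2 * m + 1) * a) a
  rw [show (2 * m + 1 : ℝ) * a + a = 2 * (m + 1) * a by ring] at e1
  rw [show (2 * m + 1 : ℝ) * a - a = 2 * m * a by ring] at e2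
  rw [e1, e2]
  ring

theorem integral_cos_mul_add_sin_sq_rpow {t : ℝ} (ht : 0 < t) :
    2 * ∫ a in (0 : ℝ)..Real.pi / 2, Real.cos a * (t + Real.sin a ^ 2) ^ (-1 / 2 : ℝ) =
      2 * Real.log (1 + Real.sqrt (t + 1)) - Real.log t := by
  have hd : ∀ a ∈ Set.uIcc 0 (Real.pi / 2), HasDerivAt
      (fun a => Real.log (Real.sin a + Real.sqrt (t + Real.sin a ^ 2)))
      (Real.cos a * (t + Real.sin a ^ 2) ^ (-1 / 2 : ℝ)) a := by
    intro a ha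
    rw [Set.uIcc_of_le (by positivity)] at ha
    have hs : 0 ≤ Real.sin a :=
      Real.sin_nonneg_of_nonneg_of_le_pi ha.1 (by linarith [ha.2, Real.pi_pos])
    have hQ := add_sin_sq_pos ht a
    have hr := Real.sqrt_pos.mpr hQ
    have h1 := ((Real.hasDerivAt_sin a).add
      ((((Real.hasDerivAt_sin a).pow 2).const_add t).sqrt hQ.ne')).log
      (by simp only [Pi.add_apply]; positivity)
    refine h1.congr_deriv ?_
    rw [show (-1 / 2 : ℝ) = -(1 / 2) by norm_num, Real.rpow_neg hQ.le, ← Real.sqrt_eq_rpow]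
    simp only [Pi.add_apply, Pi.pow_apply]
    field_simp
    ring
  rw [intervalIntegral.integral_eq_sub_of_hasDerivAt hd
    ((Real.continuous_cos.mul (continuous_add_sin_sq_rpow ht _)).intervalIntegrable _ _)]
  simp only [Real.sin_pi_div_two, Real.sin_zero, one_pow, zero_add, zero_pow two_ne_zero, add_zero,
    Real.log_sqrt ht.le]
  ring

theorem integral_sin_div_one_add_cos :
    ∫ a in (0 : ℝ)..Real.pi / 2, Real.sin a / (1 + Real.cos a) = Real.log 2 := by
  have hpos : ∀ a ∈ Set.uIcc 0 (Real.pi / 2), 0 < 1 + Real.cos a := by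
    intro a ha
    rw [Set.uIcc_of_le (by positivity)] at ha
    have := Real.cos_nonneg_of_mem_Icc ⟨by linarith [ha.1, Real.pi_pos], ha.2⟩
    linarith
  have hi : IntervalIntegrable (fun a => Real.sin a / (1 + Real.cos a)) MeasureTheory.volume 0
      (Real.pi / 2) :=
    (Real.continuous_sin.continuousOn.div (by fun_prop)
      fun a ha => (hpos a ha).ne').intervalIntegrable
  have hd : ∀ a ∈ Set.uIcc 0 (Real.pi / 2), HasDerivAt (fun a => -Real.log (1 + Real.cos a))
      (Real.sin a / (1 + Real.cos a)) a := by
    intro a ha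
    refine (((Real.hasDerivAt_cos a).const_add 1).log (hpos a ha).ne').neg.congr_deriv ?_
    ring
  rw [intervalIntegral.integral_eq_sub_of_hasDerivAt hd hi]
  norm_num

/-- Split 1 = cos a + (1 - cos a). The cosine part has an elementary primitive and yields -log t + 2
log 2; the rest converges, since 1 - cos a = sin a · sin a/(1 + cos a), and gives another 2 log 2.
-/
theorem tendsto_quarterIntegral_zero_add_log :
    Filter.Tendsto (fun t : ℝ => 2 * quarterIntegral 0 (-1 / 2) t + Real.log t)
      (nhdsWithin 0 (Set.Ioi 0)) (nhds (4 * Real.log 2)) := by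
  have h := (tendsto_integral_mul_add_sin_sq_rpow
    (g := fun a => 1 - Real.cos a)
    (h := fun a => Real.sin a / (1 + Real.cos a)) (by fun_prop) (fun a ha => by
      have hs : 0 ≤ Real.sin a :=
        Real.sin_nonneg_of_nonneg_of_le_pi ha.1.le (by linarith [ha.2, Real.pi_pos])
      have hc := Real.cos_nonneg_of_mem_Icc ⟨by linarith [ha.1, Real.pi_pos], ha.2⟩
      rw [abs_of_nonneg (by linarith [Real.cos_le_one a])]
      nlinarith [Real.sin_sq_add_cos_sq a, Real.cos_le_one a, Real.sin_le_one a]) (fun a ha => by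
      have hc := Real.cos_nonneg_of_mem_Icc ⟨by linarith [ha.1, Real.pi_pos], ha.2⟩
      field_simp
      nlinarith [Real.sin_sq_add_cos_sq a])).const_mul 2
  rw [integral_sin_div_one_add_cos] at h
  have h2 : Filter.Tendsto (fun t : ℝ => 2 * Real.log (1 + Real.sqrt (t + 1)))
      (nhdsWithin 0 (Set.Ioi 0)) (nhds (2 * Real.log 2)) := by
    have hc : ContinuousAt (fun t : ℝ => 2 * Real.log (1 + Real.sqrt (t + 1))) 0 := by
      refine continuousAt_const.mul (ContinuousAt.log (by fun_prop) ?_)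
      positivity
    have := hc.tendsto.mono_left (nhdsWithin_le_nhds (s := Set.Ioi 0))
    norm_num at this
    exact this
  have h3 := h.add h2
  rw [show 2 * Real.log 2 + 2 * Real.log 2 = 4 * Real.log 2 by ring] at h3
  refine h3.congr' ?_
  filter_upwards [self_mem_nhdsWithin] with t ht
  have e := integral_cos_mul_add_sin_sq_rpow ht
  have hq : quarterIntegral 0 (-1 / 2) t =
      (∫ a in (0 : ℝ)..Real.pi / 2, (1 - Real.cos a) * (t + Real.sin a ^ 2) ^ (-1 / 2 : ℝ)) +
      ∫ a in (0 : ℝ)..Real.pi / 2, Real.cos a * (t + Real.sin a ^ 2) ^ (-1 / 2 : ℝ) := by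
    have hc : ∀ g : ℝ → ℝ, Continuous g → IntervalIntegrable
        (fun a : ℝ => g a * (t + Real.sin a ^ 2) ^ (-1 / 2 : ℝ))
        MeasureTheory.volume 0 (Real.pi / 2) := fun g hg =>
      (hg.mul (continuous_add_sin_sq_rpow ht _)).intervalIntegrable _ _
    rw [← intervalIntegral.integral_add (hc _ (by fun_prop)) (hc _ (by fun_prop))]
    refine intervalIntegral.integral_congr fun a _ => ?_
    simp
    ring
  rw [hq]
  linarith

/-- Induction on m: ψ(q + 1) = ψ(q) + 1/q changes the digamma constant by -4/(2m+1), the same amount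
as the integrals. The base case is 2ψ(1) - 2ψ(1/2) = 4 log 2. -/
theorem tendsto_quarterIntegral_add_log (m : ℕ) :
    Filter.Tendsto (fun t : ℝ => ((2 * quarterIntegral m (-1 / 2) t + Real.log t : ℝ) : ℂ))
      (nhdsWithin 0 (Set.Ioi 0)) (nhds (digammaPart m 0)) := by
  induction m with
  | zero =>
    have h := (Complex.continuous_ofReal.tendsto _).comp tendsto_quarterIntegral_zero_add_log
    have e : digammaPart 0 0 = ((4 * Real.log 2 : ℝ) : ℂ) := by
      simp only [digammaPart, Nat.cast_zero, add_zero, Int.cast_zero, sub_zero,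
        Complex.digamma_one, Complex.digamma_one_half]
      have : ((Real.log 2 : ℝ) : ℂ) = Complex.log 2 := by
        rw [Complex.ofReal_log (by norm_num), Complex.ofReal_ofNat]
      rw [Complex.ofReal_mul, this, Complex.ofReal_ofNat]
      ring
    simpa only [Nat.cast_zero, e, Function.comp_def] using! h
  | succ m ih =>
    have h := (Complex.continuous_ofReal.tendsto _).comp (tendsto_quarterIntegral_succ_sub m)
    have h2 := h.add ih
    have e : ((-4 / (2 * m + 1) : ℝ) : ℂ) + digammaPart m 0 = digammaPart (m + 1 : ℕ) 0 := by
      have e2 := Complex.digamma_apply_add_one (1 / 2 + (m : ℂ)) (fun j => by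
        simpa using half_add_int_add_nat_ne m 0 j)
      have e3 := Complex.digamma_apply_add_one (1 / 2 - ((m + 1 : ℕ) : ℂ)) (fun j => by
        have := half_add_int_add_nat_ne (-(m + 1 : ℕ)) 0 j
        push_cast at this ⊢
        simpa [sub_eq_add_neg] using this)
      have h1 : (2 * (m : ℂ) + 1) ≠ 0 := by exact_mod_cast (2 * m).succ_ne_zero
      rw [show (1 / 2 + (m : ℂ))⁻¹ = 2 / (2 * m + 1) by
        rw [show 1 / 2 + (m : ℂ) = (2 * m + 1) / 2 by ring, inv_div]] at e2
      rw [show (1 / 2 - ((m + 1 : ℕ) : ℂ))⁻¹ = -2 / (2 * m + 1) by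
          push_cast
          rw [show (1 / 2 - ((m : ℂ) + 1)) = -(2 * m + 1) / 2 by ring]
          field_simp,
        show 1 / 2 - ((m + 1 : ℕ) : ℂ) + 1 = 1 / 2 - (m : ℂ) by push_cast; ring] at e3
      simp only [digammaPart, Nat.cast_zero, add_zero, Int.cast_natCast]
      rw [show 1 / 2 + ((m + 1 : ℕ) : ℂ) = 1 / 2 + (m : ℂ) + 1 by push_cast; ring, e2, e3]
      push_cast
      ring
    rw [e] at h2
    refine h2.congr fun t => ?_
    simp only [Function.comp_apply]
    push_cast
    ring

theorem quarterIntegral_neg (m : ℤ) (q t : ℝ) : quarterIntegral (-m) q t = quarterIntegral m q t := by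
  rw [quarterIntegral, quarterIntegral]
  refine intervalIntegral.integral_congr fun a _ => ?_
  push_cast
  rw [show 2 * -(m : ℝ) * a = -(2 * m * a) by ring, Real.cos_neg]

theorem tendsto_quarterIntegral_int_add_log (m : ℤ) :
    Filter.Tendsto (fun t : ℝ => ((2 * quarterIntegral m (-1 / 2) t + Real.log t : ℝ) : ℂ))
      (nhdsWithin 0 (Set.Ioi 0)) (nhds (digammaPart m 0)) := by
  obtain ⟨n, rfl | rfl⟩ := m.eq_nat_or_neg
  · exact tendsto_quarterIntegral_add_log n
  · simp only [quarterIntegral_neg]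
    have : digammaPart (-n) 0 = digammaPart n 0 := by
      simp only [digammaPart]
      push_cast
      ring_nf
    rw [this]
    exact tendsto_quarterIntegral_add_log n

theorem abs_cos_sub_cos_le (m : ℤ) {a : ℝ} (ha : a ∈ Set.Icc 0 (Real.pi / 2)) :
    |Real.cos (2 * m * a) - Real.cos a| ≤ (4 * (m : ℝ) ^ 2 + 1) / 2 * (Real.pi / 2) ^ 2 *
      Real.sin a ^ 2 := by
  have h1 := Real.one_sub_sq_div_two_le_cos (x := 2 * m * a)
  have h2 := Real.one_sub_sq_div_two_le_cos (x := a)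
  have h3 := Real.cos_le_one (2 * m * a)
  have h4 := Real.cos_le_one a
  have h5 : a ≤ Real.pi / 2 * Real.sin a := by
    have := Real.mul_le_sin ha.1 ha.2
    have hp := Real.pi_pos
    calc a = Real.pi / 2 * (2 / Real.pi * a) := by field_simp
      _ ≤ _ := by gcongr
  have h6 : a ^ 2 ≤ (Real.pi / 2 * Real.sin a) ^ 2 := pow_le_pow_left₀ ha.1 h5 2
  have h7 : (4 * (m : ℝ) ^ 2 + 1) / 2 * a ^ 2 ≤
      (4 * (m : ℝ) ^ 2 + 1) / 2 * (Real.pi / 2 * Real.sin a) ^ 2 := by gcongr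
  have h8 : 0 ≤ (m : ℝ) ^ 2 * a ^ 2 := by positivity
  have h9 := sq_nonneg a
  rw [abs_le]
  constructor <;> linarith

theorem integral_cos_mul_add_sin_sq_rpow' {t : ℝ} (ht : 0 < t) :
    t * ∫ a in (0 : ℝ)..Real.pi / 2, Real.cos a * (t + Real.sin a ^ 2) ^ (-3 / 2 : ℝ) =
      (t + 1) ^ (-1 / 2 : ℝ) := by
  have hd : ∀ a ∈ Set.uIcc 0 (Real.pi / 2), HasDerivAt
      (fun a => Real.sin a * (t + Real.sin a ^ 2) ^ (-1 / 2 : ℝ))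
      (t * (Real.cos a * (t + Real.sin a ^ 2) ^ (-3 / 2 : ℝ))) a := by
    intro a _
    have hQ := add_sin_sq_pos ht a
    refine ((Real.hasDerivAt_sin a).mul (hasDerivAt_add_sin_sq_rpow ht (-1 / 2) a)).congr_deriv ?_
    rw [show (-1 / 2 - 1 : ℝ) = -3 / 2 by norm_num,
      rpow_add_nat_eq hQ (-1 / 2) (-3 / 2) 1 (by norm_num)]
    ring
  rw [← intervalIntegral.integral_const_mul, intervalIntegral.integral_eq_sub_of_hasDerivAt hd
    ((continuous_const.mul
      (Real.continuous_cos.mul (continuous_add_sin_sq_rpow ht _))).intervalIntegrable _ _)]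
  simp

/-- Replacing cos(2ma) by cos a makes the integral elementary. The error is controlled by |cos(2ma)
- cos a| ≤ C sin² a, which raises the exponent to -1/2 and leaves O(√t). -/
theorem tendsto_mul_quarterIntegral (m : ℤ) :
    Filter.Tendsto (fun t : ℝ => t * quarterIntegral m (-3 / 2) t)
      (nhdsWithin 0 (Set.Ioi 0)) (nhds 1) := by
  set C : ℝ := (4 * (m : ℝ) ^ 2 + 1) / 2 * (Real.pi / 2) ^ 2 with hC
  have hC0 : 0 ≤ C := by positivity
  have h1 : Filter.Tendsto (fun t : ℝ => (t + 1) ^ (-1 / 2 : ℝ)) (nhdsWithin 0 (Set.Ioi 0))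
      (nhds 1) := by
    have hc : ContinuousAt (fun t : ℝ => (t + 1) ^ (-1 / 2 : ℝ)) 0 :=
      ContinuousAt.rpow_const (by fun_prop) (Or.inl (by norm_num))
    simpa using hc.tendsto.mono_left (nhdsWithin_le_nhds (s := Set.Ioi 0))
  have h2 : Filter.Tendsto (fun t : ℝ => C * t ^ (1 / 2 : ℝ) * |Real.pi / 2 - 0|)
      (nhdsWithin 0 (Set.Ioi 0)) (nhds 0) := by
    have hc : ContinuousAt (fun t : ℝ => C * t ^ (1 / 2 : ℝ) * |Real.pi / 2 - 0|) 0 := by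
      refine (continuousAt_const.mul ?_).mul continuousAt_const
      exact continuousAt_id.rpow_const (Or.inr (by norm_num))
    simpa using hc.tendsto.mono_left (nhdsWithin_le_nhds (s := Set.Ioi 0))
  have h3 : Filter.Tendsto (fun t : ℝ => t * quarterIntegral m (-3 / 2) t -
      (t + 1) ^ (-1 / 2 : ℝ)) (nhdsWithin 0 (Set.Ioi 0)) (nhds 0) := by
    refine squeeze_zero_norm' ?_ h2
    filter_upwards [self_mem_nhdsWithin] with t ht
    have ht : 0 < t := ht
    have hc : ∀ g : ℝ → ℝ, Continuous g → IntervalIntegrable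
        (fun a : ℝ => g a * (t + Real.sin a ^ 2) ^ (-3 / 2 : ℝ))
        MeasureTheory.volume 0 (Real.pi / 2) := fun g hg =>
      (hg.mul (continuous_add_sin_sq_rpow ht _)).intervalIntegrable _ _
    rw [← integral_cos_mul_add_sin_sq_rpow' ht, quarterIntegral, ← mul_sub,
      ← intervalIntegral.integral_sub (hc _ (by fun_prop)) (hc _ (by fun_prop)),
      ← intervalIntegral.integral_const_mul]
    refine intervalIntegral.norm_integral_le_of_norm_le_const fun a ha => ?_
    rw [Set.uIoc_of_le (by positivity)] at ha
    have hQ := add_sin_sq_pos ht a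
    have hb := abs_cos_sub_cos_le m ⟨ha.1.le, ha.2⟩
    rw [← hC] at hb
    have hX : 0 < (t + Real.sin a ^ 2) ^ (-3 / 2 : ℝ) := Real.rpow_pos_of_pos hQ _
    rw [← sub_mul, norm_mul, norm_mul, Real.norm_of_nonneg ht.le, Real.norm_of_nonneg hX.le,
      Real.norm_eq_abs]
    have e1 := rpow_add_nat_eq hQ (-1 / 2) (-3 / 2) 1 (by norm_num)
    have e2 : (t + Real.sin a ^ 2) ^ (-1 / 2 : ℝ) ≤ t ^ (-1 / 2 : ℝ) :=
      Real.rpow_le_rpow_of_nonpos ht (by nlinarith [sq_nonneg (Real.sin a)]) (by norm_num)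
    have e3 := rpow_add_nat_eq ht (1 / 2) (-1 / 2) 1 (by norm_num)
    calc _ ≤ t * (C * (t + Real.sin a ^ 2) * (t + Real.sin a ^ 2) ^ (-3 / 2 : ℝ)) := by
          gcongr
          refine hb.trans ?_
          gcongr
          linarith
      _ = C * (t * (t + Real.sin a ^ 2) ^ (-1 / 2 : ℝ)) := by rw [e1]; ring
      _ ≤ C * (t * t ^ (-1 / 2 : ℝ)) := by gcongr
      _ = _ := by rw [e3]; ring
  simpa using h3.add h1

/-! ### Matching the integral with the Frobenius series for small t. -/

namespace PolyGrowth

variable {a d : ℕ → ℂ}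

theorem tendsto_logSeries_add (ha : PolyGrowth a) (hd : PolyGrowth d) :
    Filter.Tendsto (fun u : ℝ => logSeries a d u + a 0 * u) Filter.atBot (nhds (d 0)) := by
  have h := hd.tendsto_seriesSum.sub ha.tendsto_mul_seriesSum_sub
  rw [sub_zero] at h
  refine h.congr fun u => ?_
  rw [logSeries]
  ring

theorem tendsto_logSeries (ha : PolyGrowth a) (hd : PolyGrowth d) (h0 : a 0 = 0) :
    Filter.Tendsto (logSeries a d) Filter.atBot (nhds (d 0)) := by
  simpa [h0] using ha.tendsto_logSeries_add hd

end PolyGrowth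

theorem polyGrowth_zero : PolyGrowth (fun _ => 0) := ⟨0, 0, fun k => by simp⟩

theorem isLegendreSolution_hypCoeff (m : ℤ) :
    IsLegendreSolution m (logSeries (fun _ => 0) (hypCoeff m))
      (logSeries (fun k => (k : ℂ) * 0) (fun k => (k : ℂ) * hypCoeff m k - 0))
      (logSeries (fun k => (k : ℂ) * ((k : ℂ) * 0))
        (fun k => (k : ℂ) * ((k : ℂ) * hypCoeff m k - 0) - (k : ℂ) * 0)) :=
  polyGrowth_zero.isLegendreSolution_logSeries (polyGrowth_hypCoeff m) (by simp)
    fun k => by linear_combination hypCoeff_succ m k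

/-- Formally, the coefficients a(k) times the digamma part are -∂a/∂k: the digamma increment is
minus the logarithmic derivative in k of a(k+1)/a(k). Their recurrence is thus the k-derivative of
the one for a(k). -/
theorem isLegendreSolution_hypCoeff_digammaPart (m : ℤ) :
    IsLegendreSolution m
      (logSeries (hypCoeff m) (fun k => hypCoeff m k * digammaPart m k))
      (logSeries (fun k => (k : ℂ) * hypCoeff m k)
        (fun k => (k : ℂ) * (hypCoeff m k * digammaPart m k) - hypCoeff m k))
      (logSeries (fun k => (k : ℂ) * ((k : ℂ) * hypCoeff m k))
        (fun k => (k : ℂ) * ((k : ℂ) * (hypCoeff m k * digammaPart m k) - hypCoeff m k)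
          - (k : ℂ) * hypCoeff m k)) := by
  refine (polyGrowth_hypCoeff m).isLegendreSolution_logSeries
    ((polyGrowth_hypCoeff m).mul (polyGrowth_digammaPart m)) (hypCoeff_succ m) fun k => ?_
  obtain ⟨h1, h2⟩ := half_add_mul_half_sub_ne_zero m k
  have h3 : (k : ℂ) + 1 ≠ 0 := by exact_mod_cast k.succ_ne_zero
  have hd : ((k : ℂ) + 1) * (((k : ℂ) + 1 / 2) ^ 2 - (m : ℂ) ^ 2) * digammaPart m (k + 1) =
      ((k : ℂ) + 1) * (((k : ℂ) + 1 / 2) ^ 2 - (m : ℂ) ^ 2) * digammaPart m k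
      + 2 * (((k : ℂ) + 1 / 2) ^ 2 - (m : ℂ) ^ 2) - (2 * (k : ℂ) + 1) * ((k : ℂ) + 1) := by
    rw [digammaPart_succ]
    have e : ((k : ℂ) + 1 / 2) ^ 2 - (m : ℂ) ^ 2 = (1 / 2 + m + k) * (1 / 2 - m + k) := by ring
    rw [e]
    generalize hx : (1 / 2 + (m : ℂ) + k) = x at *
    generalize hy : (1 / 2 - (m : ℂ) + k) = y at *
    have e2 : 2 * (k : ℂ) + 1 = x + y := by rw [← hx, ← hy]; ring
    rw [e2]
    field_simp
    ring
  refine mul_left_cancel₀ h3 ?_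
  have h := hypCoeff_succ m k
  linear_combination (((k : ℂ) + 1) * digammaPart m (k + 1) - 2) * h + hypCoeff m k * hd

/-- The difference of the two solutions tends to 0 with its derivative. The pure power series, which
tends to 1, serves as the comparison solution for uniqueness. -/
theorem eventually_diagonalIntegral_eq (m : ℤ) : ∀ᶠ u in Filter.atBot,
    diagonalIntegral m u = logSeries (hypCoeff m) (fun k => hypCoeff m k * digammaPart m k) u := by
  have pc := polyGrowth_hypCoeff m
  have pd := pc.mul (polyGrowth_digammaPart m)
  have h := (isLegendreSolution_diagonalIntegral m).sub (isLegendreSolution_hypCoeff_digammaPart m)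
  have hexp := Real.tendsto_exp_atBot_nhdsGT
  have h0 : Filter.Tendsto (fun u => diagonalIntegral m u -
      logSeries (hypCoeff m) (fun k => hypCoeff m k * digammaPart m k) u) Filter.atBot (nhds 0) := by
    have e := ((tendsto_quarterIntegral_int_add_log m).comp hexp).sub
      (pc.tendsto_logSeries_add pd)
    simp only [hypCoeff_zero, one_mul, sub_self] at e
    refine e.congr fun u => ?_
    simp only [Function.comp_apply, diagonalIntegral, Real.log_exp, Complex.ofReal_add]
    ring
  have h1 : Filter.Tendsto (fun u : ℝ =>
      ((-(Real.exp u * quarterIntegral m (-3 / 2) (Real.exp u)) : ℝ) : ℂ) -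
      logSeries (fun k => (k : ℂ) * hypCoeff m k)
        (fun k => (k : ℂ) * (hypCoeff m k * digammaPart m k) - hypCoeff m k) u)
      Filter.atBot (nhds 0) := by
    have e := ((Complex.continuous_ofReal.tendsto _).comp
      ((tendsto_mul_quarterIntegral m).comp hexp).neg).sub
      (pc.natCast_mul.tendsto_logSeries (pd.natCast_mul.sub pc) (by simp))
    simpa [hypCoeff_zero, Function.comp_def] using e
  have hz0 := polyGrowth_zero.tendsto_logSeries pc rfl
  rw [hypCoeff_zero] at hz0
  have hz1 := polyGrowth_zero.natCast_mul.tendsto_logSeries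
    (pc.natCast_mul.sub polyGrowth_zero) (by simp)
  simp only [Nat.cast_zero, zero_mul, sub_zero] at hz1
  have hz := isLegendreSolution_hypCoeff m
  simp only [sub_zero] at hz
  filter_upwards [h.eventually_eq_zero hz h0 h1 hz0 hz1] with u hu using sub_eq_zero.mp hu

theorem exists_quarterIntegral_eq (m : ℤ) : ∃ δ : ℝ, 0 < δ ∧ δ < 1 ∧ ∀ t : ℝ, 0 < t → t < δ →
    ((2 * quarterIntegral m (-1 / 2) t : ℝ) : ℂ) =
      ∑' k, diagonalTerm m (-(t : ℂ)) (Complex.log t) k := by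
  obtain ⟨v, hv⟩ := Filter.eventually_atBot.mp
    ((eventually_diagonalIntegral_eq m).and (Filter.eventually_lt_atBot 0))
  have hv0 : v < 0 := (hv v le_rfl).2
  refine ⟨Real.exp v, Real.exp_pos v, Real.exp_lt_one_iff.mpr hv0, fun t ht htv => ?_⟩
  have hu : Real.log t < v := (Real.log_lt_iff_lt_exp ht).mpr htv
  have h := (hv _ hu.le).1
  have hn := norm_neg_exp_lt_one (hu.trans hv0)
  rw [Real.exp_log ht] at hn
  rw [diagonalIntegral, logSeries, Real.exp_log ht] at h
  rw [h, (hasSum_diagonalTerm m hn _).tsum_eq, Complex.ofReal_log ht.le]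

/-! ### The inner integral. -/

/-- Mean value property at the centre of the unit disc for the holomorphic function 1/(1 - rw). -/
theorem integral_inv_one_sub_mul_exp {r : ℂ} (hr : ‖r‖ < 1) :
    ∫ x in (-Real.pi)..Real.pi, (1 - r * Complex.exp (x * Complex.I))⁻¹ = 2 * Real.pi := by
  have hne : ∀ w : ℂ, ‖w‖ ≤ 1 → 1 - r * w ≠ 0 := fun w hw h => by
    have h1 : r * w = 1 := (sub_eq_zero.mp h).symm
    have h2 := congrArg norm h1
    rw [norm_mul, norm_one] at h2
    nlinarith [norm_nonneg r, norm_nonneg w]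
  have hd : DiffContOnCl ℂ (fun w : ℂ => (1 - r * w)⁻¹) (Metric.ball 0 |1|) := by
    refine DifferentiableOn.diffContOnCl fun w hw => ?_
    rw [abs_one, closure_ball _ one_ne_zero, mem_closedBall_zero_iff] at hw
    exact DifferentiableWithinAt.inv (by fun_prop) (hne w hw)
  have h := hd.circleAverage
  rw [Real.circleAverage_def] at h
  simp only [circleMap_zero, Complex.ofReal_one, one_mul, mul_zero, sub_zero, inv_one] at h
  have hp : Function.Periodic (fun x : ℝ => (1 - r * Complex.exp (x * Complex.I))⁻¹)
      (2 * Real.pi) := fun x => by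
    simp only
    rw [show ((x + 2 * Real.pi : ℝ) : ℂ) * Complex.I = x * Complex.I + 2 * Real.pi * Complex.I by
      push_cast; ring, Complex.exp_periodic]
  have hs := hp.intervalIntegral_add_eq 0 (-Real.pi)
  rw [zero_add, show -Real.pi + 2 * Real.pi = Real.pi by ring] at hs
  rw [← hs]
  have h2 : ((2 * Real.pi : ℝ) : ℂ) ≠ 0 := by exact_mod_cast Real.two_pi_pos.ne'
  rw [Complex.real_smul, Complex.ofReal_inv, inv_mul_eq_iff_eq_mul₀ h2] at h
  rw [h]
  push_cast
  ring

/-- The norm condition selects the root s for which r = c/(l + s) lies in the unit disc. Then 2(l -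
c cos x) = (l + s)(1 - re^{ix})(1 - re^{-ix}), and partial fractions reduce to the mean value
property, as for the Poisson kernel. -/
theorem integral_inv_sub_mul_cos {l s c : ℂ} (hs : s ^ 2 = l ^ 2 - c ^ 2) (hs0 : s ≠ 0)
    (hc : ‖c‖ < ‖l + s‖) :
    ∫ x in (-Real.pi)..Real.pi, (l - c * Complex.cos x)⁻¹ = 2 * Real.pi / s := by
  have hq : l + s ≠ 0 := norm_pos_iff.mp ((norm_nonneg c).trans_lt hc)
  obtain ⟨r, hr⟩ : ∃ r, r = c / (l + s) := ⟨_, rfl⟩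
  have hr1 : ‖r‖ < 1 := by
    rw [hr, norm_div, div_lt_one (norm_pos_iff.mpr hq)]
    exact hc
  have hcr : c = r * (l + s) := by rw [hr]; field_simp
  have hls : l - s = r ^ 2 * (l + s) := by
    refine mul_right_cancel₀ hq ?_
    linear_combination -hs + (c + r * (l + s)) * hcr
  have hne : ∀ w : ℂ, ‖w‖ = 1 → 1 - r * w ≠ 0 := fun w hw h => by
    have h1 : r * w = 1 := (sub_eq_zero.mp h).symm
    have h2 := congrArg norm h1
    rw [norm_mul, norm_one, hw] at h2
    linarith
  have hpt : ∀ x : ℝ, (l - c * Complex.cos x)⁻¹ = s⁻¹ * ((1 - r * Complex.exp (x * Complex.I))⁻¹ +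
      (1 - r * Complex.exp (((-x : ℝ) : ℂ) * Complex.I))⁻¹ - 1) := by
    intro x
    have h1 := hne _ (Complex.norm_exp_ofReal_mul_I x)
    have h2 := hne _ (Complex.norm_exp_ofReal_mul_I (-x))
    have h3 : Complex.exp (x * Complex.I) * Complex.exp (((-x : ℝ) : ℂ) * Complex.I) = 1 := by
      rw [← Complex.exp_add]
      push_cast
      rw [neg_mul, add_neg_cancel, Complex.exp_zero]
    have h4 : 2 * Complex.cos x = Complex.exp (x * Complex.I) +
        Complex.exp (((-x : ℝ) : ℂ) * Complex.I) := by
      rw [Complex.two_cos]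
      push_cast
      rfl
    generalize Complex.exp (x * Complex.I) = p at *
    generalize Complex.exp (((-x : ℝ) : ℂ) * Complex.I) = p' at *
    have h5 : 2 * (l - c * Complex.cos x) = (l + s) * ((1 - r * p) * (1 - r * p')) := by
      linear_combination hls - c * h4 - (p + p') * hcr - (l + s) * r ^ 2 * h3
    have h6 : 2 * s = (l + s) * (1 - r ^ 2) := by linear_combination -hls
    have h7 : l - c * Complex.cos x ≠ 0 := fun h => by
      rw [h, mul_zero] at h5
      exact mul_ne_zero hq (mul_ne_zero h1 h2) h5.symm
    have h8 : (1 - r * p)⁻¹ + (1 - r * p')⁻¹ - 1 =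
        (1 - r ^ 2) / ((1 - r * p) * (1 - r * p')) := by
      field_simp
      linear_combination (-r ^ 2) * h3
    rw [h8, ← div_eq_inv_mul, div_div, inv_eq_one_div,
      div_eq_div_iff h7 (mul_ne_zero (mul_ne_zero h1 h2) hs0)]
    refine mul_left_cancel₀ hq ?_
    linear_combination (l - c * Complex.cos x) * h6 - s * h5
  have hint : ∀ y : ℝ → ℝ, Continuous y → IntervalIntegrable
      (fun x : ℝ => (1 - r * Complex.exp ((y x : ℂ) * Complex.I))⁻¹) MeasureTheory.volume
      (-Real.pi) Real.pi := fun y hy =>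
    (Continuous.inv₀ (by fun_prop)
      fun x => hne _ (Complex.norm_exp_ofReal_mul_I _)).intervalIntegrable _ _
  have hi1 : IntervalIntegrable (fun x : ℝ => (1 - r * Complex.exp ((x : ℂ) * Complex.I))⁻¹)
      MeasureTheory.volume (-Real.pi) Real.pi := hint _ continuous_id
  have hi2 := hint _ continuous_neg
  have hneg := intervalIntegral.integral_comp_neg (a := -Real.pi) (b := Real.pi)
    (fun x : ℝ => (1 - r * Complex.exp ((x : ℂ) * Complex.I))⁻¹)
  rw [neg_neg, integral_inv_one_sub_mul_exp hr1] at hneg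
  simp_rw [hpt]
  rw [intervalIntegral.integral_const_mul, intervalIntegral.integral_sub
    (hi1.add hi2) intervalIntegrable_const, intervalIntegral.integral_add hi1 hi2, hneg,
    integral_inv_one_sub_mul_exp hr1, intervalIntegral.integral_const, Complex.real_smul]
  push_cast
  ring

/-! ### Reduction of the lattice Green function to half-angle form. -/

/-- The spectrum of the discrete Laplacian on the square lattice, as a set of complex numbers. -/
def greenSpectrum : Set ℂ := (fun x : ℝ => (x : ℂ)) '' Set.Icc 0 8

theorem isClosed_greenSpectrum : IsClosed greenSpectrum :=
  (isCompact_Icc.image Complex.continuous_ofReal).isClosed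

theorem symbol_mem_greenSpectrum (x y : ℝ) :
    2 * ((2 : ℕ) : ℂ) - (2 * Complex.cos x + 2 * Complex.cos y) ∈ greenSpectrum := by
  refine ⟨4 - (2 * Real.cos x + 2 * Real.cos y), ⟨?_, ?_⟩, by push_cast; ring⟩
  · linarith [Real.cos_le_one x, Real.cos_le_one y]
  · linarith [Real.neg_one_le_cos x, Real.neg_one_le_cos y]

theorem symbol_sub_ne_zero {z : ℂ} (hz : z ∉ greenSpectrum) (x y : ℝ) :
    2 * ((2 : ℕ) : ℂ) - (2 * Complex.cos x + 2 * Complex.cos y) - z ≠ 0 := fun h =>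
  hz (sub_eq_zero.mp h ▸ symbol_mem_greenSpectrum x y)

theorem latticeGreen_two_eq_integral {z : ℂ} (hz : z ∉ greenSpectrum) (m : ℤ) :
    latticeGreen 2 z ![m, m] = ((2 * Real.pi : ℝ) : ℂ)⁻¹ ^ 2 *
      ∫ x in (-Real.pi)..Real.pi, ∫ y in (-Real.pi)..Real.pi,
        Complex.exp (Complex.I * (m * x + m * y)) /
          (2 * ((2 : ℕ) : ℂ) - (2 * Complex.cos x + 2 * Complex.cos y) - z) := by
  have hle : -Real.pi ≤ Real.pi := by linarith [Real.pi_pos]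
  set g : ℝ × ℝ → ℂ := fun p => Complex.exp (Complex.I * (m * p.1 + m * p.2)) /
          (2 * ((2 : ℕ) : ℂ) - (2 * Complex.cos p.1 + 2 * Complex.cos p.2) - z) with hg
  have hcont : Continuous g :=
    Continuous.div (by fun_prop) (by fun_prop) fun p => symbol_sub_ne_zero hz p.1 p.2
  have h1 := (MeasureTheory.volume_preserving_finTwoArrow ℝ).setIntegral_preimage_emb
    (MeasurableEquiv.finTwoArrow).measurableEmbedding g
    (Set.Icc (-Real.pi) Real.pi ×ˢ Set.Icc (-Real.pi) Real.pi)
  have h2 : (MeasurableEquiv.finTwoArrow (α := ℝ)) ⁻¹'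
      (Set.Icc (-Real.pi) Real.pi ×ˢ Set.Icc (-Real.pi) Real.pi) =
      Set.Icc (fun _ : Fin 2 => -Real.pi) (fun _ : Fin 2 => Real.pi) := by
    ext θ
    simp [MeasurableEquiv.finTwoArrow, Pi.le_def, Fin.forall_fin_two]
  rw [h2, MeasureTheory.Measure.volume_eq_prod, MeasureTheory.setIntegral_prod _
    (hcont.continuousOn.integrableOn_compact (isCompact_Icc.prod isCompact_Icc))] at h1
  rw [latticeGreen]
  congr 1
  simp only [intervalIntegral.integral_of_le hle, ← MeasureTheory.integral_Icc_eq_integral_Ioc]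
  rw [← h1]
  refine MeasureTheory.integral_congr_ae (Filter.Eventually.of_forall fun θ => ?_)
  simp [hg, MeasurableEquiv.finTwoArrow, Fin.sum_univ_two]

theorem exp_int_mul_add_two_pi (m : ℤ) (c : ℂ) :
    Complex.exp (c + Complex.I * (m * (2 * Real.pi))) = Complex.exp c := by
  rw [Complex.exp_add, show Complex.I * (m * (2 * (Real.pi : ℂ))) = m * (2 * Real.pi * Complex.I) by ring,
    Complex.exp_int_mul_two_pi_mul_I, mul_one]

theorem latticeGreen_two_eq_integral_half_angle {z : ℂ} (hz : z ∉ greenSpectrum) (m : ℤ) :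
    latticeGreen 2 z ![m, m] = ((2 * Real.pi : ℝ) : ℂ)⁻¹ ^ 2 *
      ∫ y in (-Real.pi)..Real.pi, Complex.exp (Complex.I * (m * y)) *
        (4⁻¹ * ∫ x in (-Real.pi)..Real.pi,
          ((4 - z) / 4 - Complex.cos (y / 2) * Complex.cos x)⁻¹) := by
  have hp : -Real.pi + 2 * Real.pi = Real.pi := by ring
  rw [latticeGreen_two_eq_integral hz]
  congr 1
  have hshift : ∀ x : ℝ, ∫ y in (-Real.pi)..Real.pi,
        Complex.exp (Complex.I * (m * x + m * y)) /
          (2 * ((2 : ℕ) : ℂ) - (2 * Complex.cos x + 2 * Complex.cos y) - z) =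
      ∫ y in (-Real.pi)..Real.pi, Complex.exp (Complex.I * (m * y)) /
          (2 * ((2 : ℕ) : ℂ) - (2 * Complex.cos x + 2 * Complex.cos ((y - x : ℝ) : ℂ)) - z) := by
    intro x
    have hper : Function.Periodic (fun y : ℝ => Complex.exp (Complex.I * (m * x + m * y)) /
          (2 * ((2 : ℕ) : ℂ) - (2 * Complex.cos x + 2 * Complex.cos y) - z)) (2 * Real.pi) := by
      intro y
      simp only
      push_cast
      rw [Complex.cos_add_two_pi,
        show Complex.I * (m * x + m * (y + 2 * (Real.pi : ℂ))) =
          Complex.I * (m * x + m * y) + Complex.I * (m * (2 * Real.pi)) by ring,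
        exp_int_mul_add_two_pi]
    -- By periodicity the second angle may be replaced by the sum of the angles.
    have h1 := hper.intervalIntegral_add_eq (-Real.pi) (-Real.pi - x)
    rw [hp, show -Real.pi - x + 2 * Real.pi = Real.pi - x by ring,
      ← intervalIntegral.integral_comp_sub_right] at h1
    rw [h1]
    refine intervalIntegral.integral_congr fun y _ => ?_
    push_cast
    ring_nf
  simp_rw [hshift]
  rw [MeasureTheory.intervalIntegral_intervalIntegral_swap]
  · refine intervalIntegral.integral_congr fun y _ => ?_
    have hper : Function.Periodic (fun x : ℝ => Complex.exp (Complex.I * (m * y)) /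
          (2 * ((2 : ℕ) : ℂ) - (2 * Complex.cos x + 2 * Complex.cos ((y - x : ℝ) : ℂ)) - z))
          (2 * Real.pi) := by
      intro x
      simp only
      push_cast
      rw [Complex.cos_add_two_pi, ← sub_sub (y : ℂ), Complex.cos_sub_two_pi]
    -- Translating x by y/2 turns cos x + cos(y - x) into 2 cos(y/2) cos x.
    have h1 := hper.intervalIntegral_add_eq (-Real.pi) (-Real.pi + y / 2)
    rw [hp, show -Real.pi + y / 2 + 2 * Real.pi = Real.pi + y / 2 by ring,
      ← intervalIntegral.integral_comp_add_right] at h1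
    rw [h1, ← intervalIntegral.integral_const_mul, ← intervalIntegral.integral_const_mul]
    refine intervalIntegral.integral_congr fun x _ => ?_
    push_cast
    rw [show (y - (x + y / 2) : ℂ) = y / 2 - x by ring, Complex.cos_add, Complex.cos_sub, ← mul_inv,
      div_eq_mul_inv]
    congr 2
    ring
  · refine ((Continuous.continuousOn ?_).integrableOn_compact
      (isCompact_uIcc.prod isCompact_uIcc)).mono_set
      (Set.prod_mono Set.uIoc_subset_uIcc Set.uIoc_subset_uIcc)
    exact Continuous.div (by fun_prop) (by fun_prop) fun p => symbol_sub_ne_zero hz _ _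

/-- The substitution y = 2a contributes one factor 2; pairing a with -a turns the exponentials into
2 cos(2ma). -/
theorem integral_exp_mul_add_sin_sq_rpow (m : ℤ) {t : ℝ} (ht : 0 < t) :
    ∫ y in (-Real.pi)..Real.pi, Complex.exp (Complex.I * (m * y)) *
      (((t + Real.sin (y / 2) ^ 2) ^ (-1 / 2 : ℝ) : ℝ) : ℂ) =
      ((4 * quarterIntegral m (-1 / 2) t : ℝ) : ℂ) := by
  set f : ℝ → ℂ := fun a => Complex.exp (Complex.I * (m * (2 * a))) *
      (((t + Real.sin a ^ 2) ^ (-1 / 2 : ℝ) : ℝ) : ℂ) with hf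
  have hcont : Continuous f := by
    have := Complex.continuous_ofReal.comp (continuous_add_sin_sq_rpow ht (-1 / 2))
    exact Continuous.mul (by fun_prop) this
  have h1 := intervalIntegral.integral_comp_div (a := -Real.pi) (b := Real.pi) f two_ne_zero
  have h2 := intervalIntegral.integral_add_adjacent_intervals
    (hcont.intervalIntegrable (μ := MeasureTheory.volume) (-(Real.pi / 2)) 0)
    (hcont.intervalIntegrable 0 (Real.pi / 2))
  have h3 := intervalIntegral.integral_comp_neg (a := 0) (b := Real.pi / 2) f
  rw [neg_zero] at h3
  have hcont' : Continuous fun a => f (-a) := hcont.comp continuous_neg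
  rw [neg_div, ← h2, ← h3, ← intervalIntegral.integral_add
    (hcont'.intervalIntegrable _ _) (hcont.intervalIntegrable _ _)] at h1
  rw [quarterIntegral, ← intervalIntegral.integral_const_mul, ← intervalIntegral.integral_ofReal]
  calc _ = ∫ y in (-Real.pi)..Real.pi, f (y / 2) := by
        refine intervalIntegral.integral_congr fun y _ => ?_
        simp only [hf]
        push_cast
        rw [mul_div_cancel₀ _ (two_ne_zero' ℂ)]
    _ = _ := by
        rw [h1, Complex.real_smul, ← intervalIntegral.integral_const_mul]
        refine intervalIntegral.integral_congr fun a _ => ?_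
        simp only [hf, Real.sin_neg, neg_sq]
        generalize (t + Real.sin a ^ 2) ^ (-1 / 2 : ℝ) = X
        have h4 := Complex.two_cos (2 * m * a : ℂ)
        rw [show (2 * m * a : ℂ) * Complex.I = Complex.I * (m * (2 * a)) by ring,
          show -(2 * m * a : ℂ) * Complex.I = Complex.I * (m * (2 * -a)) by ring] at h4
        push_cast
        linear_combination (-2 : ℂ) * X * h4

/-! ### Holomorphy and the identity theorem. -/

theorem differentiableOn_latticeGreen_two (n : Fin 2 → ℤ) :
    DifferentiableOn ℂ (fun z => latticeGreen 2 z n) greenSpectrumᶜ := by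
  intro z₀ hz₀
  obtain ⟨ε, hε, hball⟩ := Metric.isOpen_iff.mp isClosed_greenSpectrum.isOpen_compl z₀ hz₀
  have hball2 : ∀ z ∈ Metric.ball z₀ (ε / 2), z ∉ greenSpectrum := fun z hz =>
    hball (Metric.ball_subset_ball (by linarith) hz)
  have hne : ∀ z ∉ greenSpectrum, ∀ θ : Fin 2 → ℝ,
      2 * ((2 : ℕ) : ℂ) - ∑ j, 2 * Complex.cos (θ j : ℂ) - z ≠ 0 := fun z hz θ => by
    rw [Fin.sum_univ_two]
    exact symbol_sub_ne_zero hz _ _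
  -- The symbol takes values in the spectrum, at distance at least ε from z₀. On the half-radius
  -- ball the denominators therefore stay at least ε/2, which dominates the differentiated
  -- integrand.
  have hdist : ∀ z ∈ Metric.ball z₀ (ε / 2), ∀ θ : Fin 2 → ℝ,
      ε / 2 ≤ ‖2 * ((2 : ℕ) : ℂ) - ∑ j, 2 * Complex.cos (θ j : ℂ) - z‖ := fun z hz θ => by
    by_contra! hlt
    have hmem := symbol_mem_greenSpectrum (θ 0) (θ 1)
    rw [Fin.sum_univ_two] at hlt
    refine hball ?_ hmem
    rw [mem_ball_iff_norm] at hz ⊢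
    calc _ = ‖(2 * ((2 : ℕ) : ℂ) - (2 * Complex.cos (θ 0) + 2 * Complex.cos (θ 1)) - z)
          + (z - z₀)‖ := by congr 1; ring
      _ ≤ _ := norm_add_le _ _
      _ < ε := (add_lt_add hlt hz).trans_eq (add_halves ε)
  have hcont : ∀ z ∉ greenSpectrum, Continuous fun θ : Fin 2 → ℝ =>
      Complex.exp (Complex.I * ∑ j, (n j : ℂ) * (θ j : ℂ)) /
        (2 * ((2 : ℕ) : ℂ) - ∑ j, 2 * Complex.cos (θ j : ℂ) - z) := fun z hz =>
    Continuous.div (by fun_prop) (by fun_prop) (hne z hz)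
  have hK : IsCompact (Set.Icc (fun _ : Fin 2 => -Real.pi) (fun _ : Fin 2 => Real.pi)) :=
    isCompact_Icc
  have h := (hasDerivAt_integral_of_dominated_loc_of_deriv_le
    (μ := MeasureTheory.volume.restrict
      (Set.Icc (fun _ : Fin 2 => -Real.pi) (fun _ : Fin 2 => Real.pi)))
    (F := fun z θ => Complex.exp (Complex.I * ∑ j, (n j : ℂ) * (θ j : ℂ)) /
        (2 * ((2 : ℕ) : ℂ) - ∑ j, 2 * Complex.cos (θ j : ℂ) - z))
    (F' := fun z θ => Complex.exp (Complex.I * ∑ j, (n j : ℂ) * (θ j : ℂ)) /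
        (2 * ((2 : ℕ) : ℂ) - ∑ j, 2 * Complex.cos (θ j : ℂ) - z) ^ 2)
    (x₀ := z₀) (bound := fun _ => 1 / (ε / 2) ^ 2)
    (Metric.ball_mem_nhds z₀ (half_pos hε)) ?_ ?_ ?_ ?_ ?_ ?_).2
  · exact (h.const_mul _).differentiableAt.differentiableWithinAt
  · filter_upwards [Metric.ball_mem_nhds z₀ (half_pos hε)] with z hz
    exact (hcont z (hball2 z hz)).aestronglyMeasurable
  · exact (hcont z₀ hz₀).continuousOn.integrableOn_compact hK
  · exact (Continuous.div (by fun_prop) (by fun_prop)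
      fun θ => pow_ne_zero 2 (hne z₀ hz₀ θ)).aestronglyMeasurable
  · refine Filter.Eventually.of_forall fun θ z hz => ?_
    rw [norm_div, norm_pow]
    have h1 : ‖Complex.exp (Complex.I * ∑ j, (n j : ℂ) * (θ j : ℂ))‖ = 1 := by
      rw [show Complex.I * ∑ j, (n j : ℂ) * (θ j : ℂ) =
        ((∑ j, (n j : ℝ) * θ j : ℝ) : ℂ) * Complex.I by push_cast; ring]
      exact Complex.norm_exp_ofReal_mul_I _
    rw [h1]
    have := hdist z hz θ
    gcongr
  · exact MeasureTheory.integrableOn_const hK.measure_lt_top.ne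
  · refine Filter.Eventually.of_forall fun θ z hz => ?_
    have h1 := ((hasDerivAt_id z).const_sub
      (2 * ((2 : ℕ) : ℂ) - ∑ j, 2 * Complex.cos (θ j : ℂ))).inv (hne z (hball2 z hz) θ)
    simp only [div_eq_mul_inv]
    refine (h1.const_mul _).congr_deriv ?_
    simp [div_eq_mul_inv]

/-- The unit disc without the segment `(-1, 0]`, on which the logarithmic series converges. -/
def slitDisc : Set ℂ := Complex.slitPlane ∩ Metric.ball 0 1

theorem isOpen_slitDisc : IsOpen slitDisc := Complex.isOpen_slitPlane.inter Metric.isOpen_ball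

/-- The set is star-shaped about 1/2, as an intersection of the slit plane with a convex disc. -/
theorem isPreconnected_slitDisc : IsPreconnected slitDisc := by
  have h1 : StarConvex ℝ ((1 / 2 : ℝ) : ℂ) Complex.slitPlane :=
    Complex.starConvex_ofReal_slitPlane (by norm_num)
  have hmem : ((1 / 2 : ℝ) : ℂ) ∈ Metric.ball (0 : ℂ) 1 := by
    rw [mem_ball_zero_iff, Complex.norm_real]
    norm_num
  have h2 := h1.inter ((convex_ball (0 : ℂ) 1).starConvex hmem)
  exact (h2.isPathConnected
    ⟨Complex.ofReal_mem_slitPlane.mpr (by norm_num), hmem⟩).isConnected.isPreconnected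

theorem differentiableOn_tsum_diagonalTerm (m : ℤ) :
    DifferentiableOn ℂ (fun v => ∑' k, diagonalTerm m (-v) (Complex.log v) k) slitDisc := by
  have hneg : ∀ {a : ℕ → ℂ}, PolyGrowth a →
      DifferentiableOn ℂ (fun v => seriesSum a (-v)) slitDisc := fun ha =>
    ha.differentiableOn_seriesSum.comp (by fun_prop) fun v hv => by
      simpa using hv.2
  have pc := polyGrowth_hypCoeff m
  have h := (hneg (pc.mul (polyGrowth_digammaPart m))).sub
    ((hneg pc).mul (b := Complex.log) (fun v hv =>
      (Complex.differentiableAt_log hv.1).differentiableWithinAt))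
  refine h.congr fun v hv => ?_
  exact (hasSum_diagonalTerm m (by simpa using hv.2) _).tsum_eq

theorem eqOn_tsum_diagonalTerm (m : ℤ) {g : ℂ → ℂ} (hg : DifferentiableOn ℂ g slitDisc)
    (hreal : ∀ t : ℝ, 0 < t → t < 1 → g t = ((2 * quarterIntegral m (-1 / 2) t : ℝ) : ℂ)) :
    Set.EqOn g (fun v => ∑' k, diagonalTerm m (-v) (Complex.log v) k) slitDisc := by
  obtain ⟨δ, hδ0, hδ1, hδ⟩ := exists_quarterIntegral_eq m
  have hmem : ((δ / 2 : ℝ) : ℂ) ∈ slitDisc := by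
    refine ⟨Complex.ofReal_mem_slitPlane.mpr (by linarith), ?_⟩
    rw [mem_ball_zero_iff, Complex.norm_real, Real.norm_of_nonneg (by linarith)]
    linarith
  refine (hg.analyticOnNhd isOpen_slitDisc).eqOn_of_preconnected_of_frequently_eq
    ((differentiableOn_tsum_diagonalTerm m).analyticOnNhd isOpen_slitDisc)
    isPreconnected_slitDisc hmem ?_
  -- Real points t ≠ δ/2 accumulate at δ/2 inside the complex domain, so agreement on (0, δ) alone
  -- feeds the identity theorem.
  have h1 : Filter.Tendsto (fun t : ℝ => (t : ℂ)) (nhdsWithin (δ / 2) {δ / 2}ᶜ)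
      (nhdsWithin ((δ / 2 : ℝ) : ℂ) {((δ / 2 : ℝ) : ℂ)}ᶜ) :=
    Complex.continuous_ofReal.continuousAt.continuousWithinAt.tendsto_nhdsWithin
      fun t ht h => ht (Complex.ofReal_injective h)
  refine h1.frequently (Filter.Eventually.frequently ?_)
  have h2 : Set.Ioo 0 δ ∈ nhdsWithin (δ / 2) {δ / 2}ᶜ :=
    mem_nhdsWithin_of_mem_nhds (Ioo_mem_nhds (by linarith) (by linarith))
  filter_upwards [h2] with t ht
  rw [hreal t ht.1 (ht.2.trans hδ1), hδ t ht.1 ht.2]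

/-! ### Values for real and for imaginary (4 - z)/4. -/

/-- The lattice Green function when the inner integral has the square root `s y`. -/
theorem latticeGreen_two_eq_integral_sqrt {z : ℂ} (hz : z ∉ greenSpectrum) (m : ℤ) (s : ℝ → ℂ)
    (hs : ∀ y, s y ^ 2 = ((4 - z) / 4) ^ 2 - Complex.cos (y / 2) ^ 2) (hs0 : ∀ y, s y ≠ 0)
    (hc : ∀ y : ℝ, ‖Complex.cos ((y : ℂ) / 2)‖ < ‖(4 - z) / 4 + s y‖) :
    latticeGreen 2 z ![m, m] = (8 * (Real.pi : ℂ))⁻¹ *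
      ∫ y in (-Real.pi)..Real.pi, Complex.exp (Complex.I * (m * y)) * (s y)⁻¹ := by
  rw [latticeGreen_two_eq_integral_half_angle hz]
  simp_rw [fun y : ℝ => integral_inv_sub_mul_cos (hs y) (hs0 y) (hc y)]
  have : ∀ y : ℝ, Complex.exp (Complex.I * (m * y)) * (4⁻¹ * (2 * (Real.pi : ℂ) / s y)) =
      (Real.pi / 2 : ℂ) * (Complex.exp (Complex.I * (m * y)) * (s y)⁻¹) := fun y => by ring
  simp_rw [this]
  rw [intervalIntegral.integral_const_mul, ← mul_assoc]
  congr 1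
  have hp : (Real.pi : ℂ) ≠ 0 := by exact_mod_cast Real.pi_ne_zero
  push_cast
  field_simp
  norm_num

theorem rpow_half_sq {x : ℝ} (hx : 0 < x) : ((x ^ (1 / 2 : ℝ) : ℝ) : ℂ) ^ 2 = x := by
  rw [← Complex.ofReal_pow, ← Real.rpow_natCast, ← Real.rpow_mul hx.le]
  norm_num

theorem inv_rpow_half {x : ℝ} (hx : 0 < x) :
    (((x ^ (1 / 2 : ℝ) : ℝ) : ℂ))⁻¹ = ((x ^ (-1 / 2 : ℝ) : ℝ) : ℂ) := by
  rw [← Complex.ofReal_inv, ← Real.rpow_neg hx.le]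
  norm_num

theorem not_mem_greenSpectrum_of_sq {l : ℂ} (h : ∀ x : ℝ, |x| ≤ 1 → l ≠ x) :
    4 - 4 * l ∉ greenSpectrum := by
  rintro ⟨x, hx, hxl⟩
  refine h (1 - x / 4) (by rw [abs_le]; constructor <;> linarith [hx.1, hx.2]) ?_
  simp only at hxl
  push_cast
  linear_combination (1 / 4 : ℂ) * hxl

/-- Here z is real, below 0 if σ = 1 and above 8 if σ = -1. The inner root is σ√(t + sin²(y/2)), of
the same sign as (4 - z)/4. -/
theorem latticeGreen_two_of_real (m : ℤ) {t : ℝ} (ht : 0 < t) {σ : ℝ} (hσ : σ ^ 2 = 1) :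
    latticeGreen 2 (4 - 4 * (σ * ((1 + t) ^ (1 / 2 : ℝ) : ℝ))) ![m, m] =
      σ / (4 * (Real.pi : ℂ)) * ((2 * quarterIntegral m (-1 / 2) t : ℝ) : ℂ) := by
  have hσ0 : σ ≠ 0 := by rintro rfl; norm_num at hσ
  have hσabs : |σ| = 1 :=
    (pow_eq_one_iff_of_nonneg (abs_nonneg σ) two_ne_zero).mp (by rw [sq_abs, hσ])
  have hσ' : (σ : ℂ) ^ 2 = 1 := by exact_mod_cast hσ
  have hroot : 1 < (1 + t) ^ (1 / 2 : ℝ) := Real.one_lt_rpow (by linarith) (by norm_num)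
  have hz : 4 - 4 * ((σ : ℂ) * ((1 + t) ^ (1 / 2 : ℝ) : ℝ)) ∉ greenSpectrum := by
    refine not_mem_greenSpectrum_of_sq fun x hx h => ?_
    have h1 : σ * (1 + t) ^ (1 / 2 : ℝ) = x := by exact_mod_cast h
    rw [← h1, abs_mul, hσabs, abs_of_pos (by linarith)] at hx
    linarith
  have hr := rpow_half_sq (show 0 < 1 + t by linarith)
  rw [latticeGreen_two_eq_integral_sqrt hz m
    (fun y => σ * (((t + Real.sin (y / 2) ^ 2) ^ (1 / 2 : ℝ) : ℝ) : ℂ)) (fun y => ?_) (fun y => ?_)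
    (fun y => ?_)]
  · have : ∀ y : ℝ, Complex.exp (Complex.I * (m * y)) *
        ((σ : ℂ) * (((t + Real.sin (y / 2) ^ 2) ^ (1 / 2 : ℝ) : ℝ) : ℂ))⁻¹ =
        (σ : ℂ) * (Complex.exp (Complex.I * (m * y)) *
        (((t + Real.sin (y / 2) ^ 2) ^ (-1 / 2 : ℝ) : ℝ) : ℂ)) := fun y => by
      have e : (σ : ℂ)⁻¹ = σ := inv_eq_of_mul_eq_one_left (by rw [← sq, hσ'])
      rw [mul_inv, inv_rpow_half (add_sin_sq_pos ht _), e]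
      ring
    simp_rw [this]
    rw [intervalIntegral.integral_const_mul, integral_exp_mul_add_sin_sq_rpow m ht]
    push_cast
    field_simp
    ring
  · have h1 := rpow_half_sq (add_sin_sq_pos ht (y / 2))
    have h2 := Complex.sin_sq_add_cos_sq ((y : ℂ) / 2)
    rw [mul_pow, h1]
    push_cast at hr ⊢
    linear_combination h2 - hr * σ ^ 2 - hσ' + Complex.sin ((y : ℂ) / 2) ^ 2 * hσ'
  · refine mul_ne_zero (by exact_mod_cast hσ0) ?_
    exact_mod_cast (Real.rpow_pos_of_pos (add_sin_sq_pos ht (y / 2)) _).ne'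
  · have h1 : (4 - (4 - 4 * ((σ : ℂ) * ((1 + t) ^ (1 / 2 : ℝ) : ℝ)))) / 4 +
        σ * (((t + Real.sin (y / 2) ^ 2) ^ (1 / 2 : ℝ) : ℝ) : ℂ) =
        ((σ * ((1 + t) ^ (1 / 2 : ℝ) + (t + Real.sin (y / 2) ^ 2) ^ (1 / 2 : ℝ)) : ℝ) : ℂ) := by
      push_cast
      ring
    have h2 : Complex.cos ((y : ℂ) / 2) = ((Real.cos (y / 2) : ℝ) : ℂ) := by push_cast; rfl
    have h3 := Real.rpow_pos_of_pos (add_sin_sq_pos ht (y / 2)) (1 / 2)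
    rw [h1, h2, Complex.norm_real, Complex.norm_real, Real.norm_eq_abs, Real.norm_eq_abs, abs_mul,
      hσabs, abs_of_pos (add_pos (zero_lt_one.trans hroot) h3)]
    linarith [Real.abs_cos_le_one (y / 2)]

/-- Here z = 4 + 4i√t, and the inner root is -i√(t + cos²(y/2)), pointing in the same direction as
(4 - z)/4. -/
theorem latticeGreen_two_of_imaginary (m : ℤ) {t : ℝ} (ht : 0 < t) :
    (-1 : ℂ) ^ m * latticeGreen 2 (4 - 4 * (-Complex.I * (t ^ (1 / 2 : ℝ) : ℝ))) ![m, m] =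
      Complex.I / (4 * (Real.pi : ℂ)) * ((2 * quarterIntegral m (-1 / 2) t : ℝ) : ℂ) := by
  have hroot : 0 < t ^ (1 / 2 : ℝ) := Real.rpow_pos_of_pos ht _
  have hpos : ∀ y : ℝ, 0 < t + Real.cos (y / 2) ^ 2 := fun y => by positivity
  have hz : 4 - 4 * (-Complex.I * ((t ^ (1 / 2 : ℝ) : ℝ) : ℂ)) ∉ greenSpectrum := by
    refine not_mem_greenSpectrum_of_sq fun x _ h => ?_
    have h1 := congrArg Complex.im h
    simp only [neg_mul, Complex.neg_im, Complex.I_mul_im, Complex.ofReal_re, Complex.ofReal_im] at h1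
    linarith
  have hr := rpow_half_sq ht
  rw [latticeGreen_two_eq_integral_sqrt hz m
    (fun y => -Complex.I * (((t + Real.cos (y / 2) ^ 2) ^ (1 / 2 : ℝ) : ℝ) : ℂ)) (fun y => ?_)
    (fun y => ?_) (fun y => ?_)]
  · have h1 : ∀ y : ℝ, Complex.exp (Complex.I * (m * y)) *
        (-Complex.I * (((t + Real.cos (y / 2) ^ 2) ^ (1 / 2 : ℝ) : ℝ) : ℂ))⁻¹ =
        Complex.I * (Complex.exp (Complex.I * (m * y)) *
        (((t + Real.cos (y / 2) ^ 2) ^ (-1 / 2 : ℝ) : ℝ) : ℂ)) := fun y => by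
      rw [mul_inv, inv_rpow_half (hpos y), inv_neg, Complex.inv_I, neg_neg]
      ring
    have hper : Function.Periodic (fun y : ℝ => Complex.exp (Complex.I * (m * y)) *
        (((t + Real.cos (y / 2) ^ 2) ^ (-1 / 2 : ℝ) : ℝ) : ℂ)) (2 * Real.pi) := by
      intro y
      simp only
      rw [show (y + 2 * Real.pi) / 2 = y / 2 + Real.pi by ring, Real.cos_add_pi, neg_sq,
        show Complex.I * (m * ((y + 2 * Real.pi : ℝ) : ℂ)) =
          Complex.I * (m * y) + Complex.I * (m * (2 * Real.pi)) by push_cast; ring,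
        exp_int_mul_add_two_pi]
    -- Translation of y by π exchanges cos² for sin² at the half angle and produces the sign (-1)^m.
    have h2 := hper.intervalIntegral_add_eq (-Real.pi) (-Real.pi + Real.pi)
    rw [show -Real.pi + 2 * Real.pi = Real.pi by ring,
      show -Real.pi + Real.pi + 2 * Real.pi = Real.pi + Real.pi by ring,
      ← intervalIntegral.integral_comp_add_right] at h2
    have h3 : ∀ y : ℝ, Complex.exp (Complex.I * (m * ((y + Real.pi : ℝ) : ℂ))) *
        (((t + Real.cos ((y + Real.pi) / 2) ^ 2) ^ (-1 / 2 : ℝ) : ℝ) : ℂ) =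
        (-1 : ℂ) ^ m * (Complex.exp (Complex.I * (m * y)) *
        (((t + Real.sin (y / 2) ^ 2) ^ (-1 / 2 : ℝ) : ℝ) : ℂ)) := fun y => by
      rw [show (y + Real.pi) / 2 = y / 2 + Real.pi / 2 by ring, Real.cos_add_pi_div_two, neg_sq,
        show Complex.I * (m * ((y + Real.pi : ℝ) : ℂ)) =
          Complex.I * (m * y) + m * (Real.pi * Complex.I) by push_cast; ring,
        Complex.exp_add, Complex.exp_int_mul, Complex.exp_pi_mul_I]
      ring
    simp_rw [h3] at h2
    simp_rw [h1]
    rw [intervalIntegral.integral_const_mul, h2, intervalIntegral.integral_const_mul,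
      integral_exp_mul_add_sin_sq_rpow m ht]
    have h4 : (-1 : ℂ) ^ m * (-1 : ℂ) ^ m = 1 := by
      rw [← mul_zpow]
      norm_num
    have hp : (Real.pi : ℂ) ≠ 0 := by exact_mod_cast Real.pi_ne_zero
    push_cast
    calc _ = ((-1 : ℂ) ^ m * (-1 : ℂ) ^ m) * ((8 * (Real.pi : ℂ))⁻¹ * (Complex.I *
          (4 * (quarterIntegral m (-1 / 2) t : ℂ)))) := by ring
      _ = _ := by
        rw [h4]
        field_simp
        ring
  · have h1 := rpow_half_sq (hpos y)
    rw [mul_pow, h1, neg_sq, Complex.I_sq]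
    push_cast at hr ⊢
    linear_combination hr - ((t ^ (1 / 2 : ℝ) : ℝ) : ℂ) ^ 2 * Complex.I_sq
  · refine mul_ne_zero (neg_ne_zero.mpr Complex.I_ne_zero) ?_
    exact_mod_cast (Real.rpow_pos_of_pos (hpos y) _).ne'
  · have h1 : (4 - (4 - 4 * (-Complex.I * ((t ^ (1 / 2 : ℝ) : ℝ) : ℂ)))) / 4 +
        -Complex.I * (((t + Real.cos (y / 2) ^ 2) ^ (1 / 2 : ℝ) : ℝ) : ℂ) =
        -Complex.I * ((t ^ (1 / 2 : ℝ) + (t + Real.cos (y / 2) ^ 2) ^ (1 / 2 : ℝ) : ℝ) : ℂ) := by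
      push_cast
      ring
    have h2 : Complex.cos ((y : ℂ) / 2) = ((Real.cos (y / 2) : ℝ) : ℂ) := by push_cast; rfl
    have h3 := Real.rpow_pos_of_pos (hpos y) (1 / 2)
    have h4 : |Real.cos (y / 2)| ≤ (t + Real.cos (y / 2) ^ 2) ^ (1 / 2 : ℝ) := by
      rw [← Real.sqrt_eq_rpow]
      exact Real.abs_le_sqrt (by linarith)
    rw [h1, h2, norm_mul, norm_neg, Complex.norm_I, one_mul, Complex.norm_real, Complex.norm_real,
      Real.norm_eq_abs, Real.norm_eq_abs, abs_of_pos (add_pos hroot h3)]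
    linarith

/-! ### Analytic continuation to the slit disc. -/

/-- The parametrization z = 4 - 4l with l² = 1 + v avoids the spectrum on the slit disc: l = x in
[-1,1] would put v = x² - 1 on the cut. -/
theorem latticeGreen_two_eq_tsum_of_sq_sub_one (m : ℤ) {σ : ℝ} (hσ : σ ^ 2 = 1) {v : ℂ}
    (hv : v ∈ slitDisc) :
    latticeGreen 2 (4 - 4 * (σ * (1 + v) ^ (2⁻¹ : ℂ))) ![m, m] =
      σ / (4 * (Real.pi : ℂ)) * ∑' k, diagonalTerm m (-v) (Complex.log v) k := by
  have hσ' : (σ : ℂ) ^ 2 = 1 := by exact_mod_cast hσ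
  have hp : (Real.pi : ℂ) ≠ 0 := by exact_mod_cast Real.pi_ne_zero
  have hslit : ∀ v ∈ slitDisc, 1 + v ∈ Complex.slitPlane := fun v hv =>
    Complex.mem_slitPlane_of_norm_lt_one (by simpa using hv.2)
  have hmaps : Set.MapsTo (fun v : ℂ => 4 - 4 * (σ * (1 + v) ^ (2⁻¹ : ℂ))) slitDisc
      greenSpectrumᶜ := fun v hv => by
    refine not_mem_greenSpectrum_of_sq fun x hx h => ?_
    have h1 : ((1 + v) ^ (2⁻¹ : ℂ)) ^ 2 = 1 + v := Complex.cpow_nat_inv_pow _ two_ne_zero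
    have h2 : v = ((x ^ 2 - 1 : ℝ) : ℂ) := by
      push_cast
      rw [← h]
      linear_combination -(σ : ℂ) ^ 2 * h1 - (1 + v) * hσ'
    have h3 := hv.1
    rw [h2, Complex.ofReal_mem_slitPlane] at h3
    have := (sq_le_one_iff_abs_le_one x).mpr hx
    linarith
  have hd : DifferentiableOn ℂ (fun v : ℂ => 4 * (Real.pi : ℂ) * σ *
      latticeGreen 2 (4 - 4 * (σ * (1 + v) ^ (2⁻¹ : ℂ))) ![m, m]) slitDisc := by
    refine ((differentiableOn_latticeGreen_two ![m, m]).comp (fun v hv => ?_) hmaps).const_mul _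
    exact (((DifferentiableAt.cpow (by fun_prop) (by fun_prop) (hslit v hv)).const_mul
      _).const_mul _ |>.const_sub _).differentiableWithinAt
  have h := eqOn_tsum_diagonalTerm m hd (fun t ht _ => by
    have e : (1 + (t : ℂ)) ^ (2⁻¹ : ℂ) = (((1 + t) ^ (1 / 2 : ℝ) : ℝ) : ℂ) := by
      rw [Complex.ofReal_cpow (by linarith)]
      push_cast
      norm_num
    rw [e, latticeGreen_two_of_real m ht hσ]
    generalize ((2 * quarterIntegral m (-1 / 2) t : ℝ) : ℂ) = X
    field_simp
    linear_combination X * hσ') hv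
  simp only at h
  rw [← h]
  generalize latticeGreen 2 (4 - 4 * (σ * (1 + v) ^ (2⁻¹ : ℂ))) ![m, m] = X
  field_simp
  linear_combination -X * hσ'

/-- Here l² = -v, and a real l would put v = -l² on the cut. -/
theorem latticeGreen_two_eq_tsum_of_neg_sq (m : ℤ) {v : ℂ} (hv : v ∈ slitDisc) :
    (-1 : ℂ) ^ m * latticeGreen 2 (4 - 4 * (-Complex.I * v ^ (2⁻¹ : ℂ))) ![m, m] =
      Complex.I / (4 * (Real.pi : ℂ)) * ∑' k, diagonalTerm m (-v) (Complex.log v) k := by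
  have hp : (Real.pi : ℂ) ≠ 0 := by exact_mod_cast Real.pi_ne_zero
  have hmaps : Set.MapsTo (fun v : ℂ => 4 - 4 * (-Complex.I * v ^ (2⁻¹ : ℂ))) slitDisc
      greenSpectrumᶜ := fun v hv => by
    refine not_mem_greenSpectrum_of_sq fun x _ h => ?_
    have h1 : (v ^ (2⁻¹ : ℂ)) ^ 2 = v := Complex.cpow_nat_inv_pow _ two_ne_zero
    have h2 : v = ((-(x ^ 2) : ℝ) : ℂ) := by
      push_cast
      rw [← h]
      linear_combination -h1 + (v ^ (2⁻¹ : ℂ)) ^ 2 * Complex.I_sq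
    have h3 := hv.1
    rw [h2, Complex.ofReal_mem_slitPlane] at h3
    linarith [sq_nonneg x]
  have hd : DifferentiableOn ℂ (fun v : ℂ => 4 * (Real.pi : ℂ) * -Complex.I * (-1 : ℂ) ^ m *
      latticeGreen 2 (4 - 4 * (-Complex.I * v ^ (2⁻¹ : ℂ))) ![m, m]) slitDisc := by
    refine ((differentiableOn_latticeGreen_two ![m, m]).comp (fun v hv => ?_) hmaps).const_mul _
    exact (((DifferentiableAt.cpow (by fun_prop) (by fun_prop) hv.1).const_mul
      _).const_mul _ |>.const_sub _).differentiableWithinAt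
  have h := eqOn_tsum_diagonalTerm m hd (fun t ht _ => by
    have e : (t : ℂ) ^ (2⁻¹ : ℂ) = ((t ^ (1 / 2 : ℝ) : ℝ) : ℂ) := by
      rw [Complex.ofReal_cpow ht.le]
      push_cast
      norm_num
    rw [e, mul_assoc, latticeGreen_two_of_imaginary m ht]
    generalize ((2 * quarterIntegral m (-1 / 2) t : ℝ) : ℂ) = X
    field_simp
    linear_combination -X * Complex.I_sq) hv
  simp only at h
  rw [← h]
  generalize latticeGreen 2 (4 - 4 * (-Complex.I * v ^ (2⁻¹ : ℂ))) ![m, m] = X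
  field_simp
  linear_combination X * Complex.I_sq

/-! ### Choice of branches and conclusion. -/

theorem sq_mem_slitPlane {x : ℂ} (hx : 0 < x.re) : x ^ 2 ∈ Complex.slitPlane := by
  rw [Complex.mem_slitPlane_iff, sq, Complex.mul_re, Complex.mul_im]
  by_cases h : x.im = 0
  · left
    rw [h]
    nlinarith
  · right
    have : x.re * x.im ≠ 0 := mul_ne_zero hx.ne' h
    intro h0
    exact this (by linarith)

/-- If z(z - 8)/16 = p with -1 < p ≤ 0, then z = 4 ± 4√(1 + p), which lies in [0,8]. -/
theorem mem_slitPlane_of_not_mem_spectrum {z : ℂ}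
    (hz : ¬ ∃ x : ℝ, 0 ≤ x ∧ x ≤ 8 ∧ z = (x : ℂ)) (hlt : ‖z * (z - 8) / 16‖ < 1) :
    z * (z - 8) / 16 ∈ Complex.slitPlane := by
  by_contra h
  rw [Complex.mem_slitPlane_iff] at h
  push Not at h
  obtain ⟨hre, him⟩ := h
  obtain ⟨p, hp⟩ : ∃ p : ℝ, z * (z - 8) / 16 = (p : ℂ) :=
    ⟨(z * (z - 8) / 16).re, Complex.ext rfl (by rw [him, Complex.ofReal_im])⟩
  rw [hp, Complex.ofReal_re] at hre
  rw [hp, Complex.norm_real, Real.norm_eq_abs, abs_lt] at hlt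
  have hs := Real.sq_sqrt (show 0 ≤ 1 + p by linarith)
  have hs' : ((Real.sqrt (1 + p) : ℝ) : ℂ) ^ 2 = 1 + p := by exact_mod_cast hs
  have hs0 := Real.sqrt_nonneg (1 + p)
  have hs1 : Real.sqrt (1 + p) ≤ 1 := Real.sqrt_le_one.mpr (by linarith)
  have hfac : (z - (4 - 4 * (Real.sqrt (1 + p) : ℝ))) * (z - (4 + 4 * (Real.sqrt (1 + p) : ℝ))) = 0 := by
    linear_combination 16 * hp - 16 * hs'
  rcases mul_eq_zero.mp hfac with h | h
  · refine hz ⟨4 - 4 * Real.sqrt (1 + p), by linarith, by linarith, ?_⟩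
    push_cast
    linear_combination h
  · refine hz ⟨4 + 4 * Real.sqrt (1 + p), by linarith, by linarith, ?_⟩
    push_cast
    linear_combination h

theorem proposition191230 :
    (∀ z : ℂ, ‖z - 4‖ < 4 → 0 < z.im → ∀ m : ℤ,
      Summable (diagonalTerm m (((z - 4) / 4) ^ 2) (Complex.log (-((z - 4) ^ 2 / 16)))) ∧
      diagonalValue z m =
        Complex.I / (4 * (Real.pi : ℂ)) *
          ∑' k : ℕ, diagonalTerm m (((z - 4) / 4) ^ 2)
            (Complex.log (-((z - 4) ^ 2 / 16))) k) ∧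
    (∀ z : ℂ, (¬ ∃ x : ℝ, 0 ≤ x ∧ x ≤ 8 ∧ z = (x : ℂ)) → ‖z * (8 - z)‖ < 16 → ∀ m : ℤ,
      Summable (diagonalTerm m (z * (8 - z) / 16) (Complex.log (z * (z - 8) / 16))) ∧
      (0 < (4 - z).re →
        diagonalValue z m =
          (-1 : ℂ) ^ m / (4 * (Real.pi : ℂ)) *
            ∑' k : ℕ, diagonalTerm m (z * (8 - z) / 16) (Complex.log (z * (z - 8) / 16)) k) ∧
      ((4 - z).re < 0 →
        diagonalValue z m =
          -((-1 : ℂ) ^ m / (4 * (Real.pi : ℂ))) *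
            ∑' k : ℕ, diagonalTerm m (z * (8 - z) / 16)
              (Complex.log (z * (z - 8) / 16)) k)) := by
  refine ⟨fun z hz him m => ?_, fun z hz hlt m => ?_⟩
  -- With l = (4 - z)/4, Im z > 0 says exactly that il has positive real part. So il is the
  -- principal root of -l², and -i · il = l recovers z.
  · have hx : 0 < (Complex.I * ((4 - z) / 4)).re := by
      have : (Complex.I * ((4 - z) / 4)).re = z.im / 4 := by
        rw [Complex.I_mul_re, ← Complex.ofReal_ofNat, Complex.div_ofReal_im]
        simp
        ring
      rw [this]
      linarith
    have hw : ((z - 4) / 4) ^ 2 = -(-((z - 4) ^ 2 / 16)) := by ring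
    have hv : -((z - 4) ^ 2 / 16) = (Complex.I * ((4 - z) / 4)) ^ 2 := by
      linear_combination -((4 - z) / 4) ^ 2 * Complex.I_sq
    have hnorm : ‖-((z - 4) ^ 2 / 16)‖ < 1 := by
      rw [norm_neg, norm_div, norm_pow, Complex.norm_ofNat, div_lt_one (by norm_num)]
      nlinarith [norm_nonneg (z - 4)]
    have hmem : -((z - 4) ^ 2 / 16) ∈ slitDisc :=
      ⟨hv ▸ sq_mem_slitPlane hx, mem_ball_zero_iff.mpr hnorm⟩
    refine ⟨(hasSum_diagonalTerm m ?_ _).summable, ?_⟩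
    · rw [hw, norm_neg]
      exact hnorm
    · have h := latticeGreen_two_eq_tsum_of_neg_sq m hmem
      rw [diagonalValue, hw, ← h, hv, Complex.sq_cpow_two_inv hx]
      congr 2
      linear_combination -(4 - z) * Complex.I_sq
  · have hw : z * (8 - z) / 16 = -(z * (z - 8) / 16) := by ring
    have hnorm : ‖z * (8 - z) / 16‖ < 1 := by
      rw [norm_div, Complex.norm_ofNat, div_lt_one (by norm_num)]
      exact hlt
    have hnorm' : ‖z * (z - 8) / 16‖ < 1 := by
      rwa [hw, norm_neg] at hnorm
    have hmem : z * (z - 8) / 16 ∈ slitDisc :=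
      ⟨mem_slitPlane_of_not_mem_spectrum hz hnorm', mem_ball_zero_iff.mpr hnorm'⟩
    -- The sign σ makes σ(4 - z)/4 the principal root of 1 + z(z - 8)/16 = ((4 - z)/4)², so both
    -- half-planes are treated together.
    have key : ∀ σ : ℝ, σ ^ 2 = 1 → 0 < σ * (4 - z).re → diagonalValue z m =
        (-1 : ℂ) ^ m * (σ / (4 * (Real.pi : ℂ)) *
          ∑' k, diagonalTerm m (z * (8 - z) / 16) (Complex.log (z * (z - 8) / 16)) k) := by
      intro σ hσ hre
      have hσ' : (σ : ℂ) ^ 2 = 1 := by exact_mod_cast hσ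
      have hx : 0 < ((σ : ℂ) * ((4 - z) / 4)).re := by
        rw [Complex.re_ofReal_mul, ← Complex.ofReal_ofNat 4, Complex.div_ofReal_re, Complex.ofReal_ofNat,
          ← mul_div_assoc]
        positivity
      have hv : 1 + z * (z - 8) / 16 = ((σ : ℂ) * ((4 - z) / 4)) ^ 2 := by
        linear_combination -((4 - z) / 4) ^ 2 * hσ'
      rw [diagonalValue, hw, ← latticeGreen_two_eq_tsum_of_sq_sub_one m hσ hmem, hv,
        Complex.sq_cpow_two_inv hx]
      congr 2
      linear_combination (4 - z) * hσ'
    refine ⟨(hasSum_diagonalTerm m hnorm _).summable, fun hre => ?_, fun hre => ?_⟩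
    · rw [key 1 (by norm_num) (by linarith)]
      push_cast
      ring
    · rw [key (-1) (by norm_num) (by linarith)]
      push_cast
      ring
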